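/- **Proposition (Poisson structure on weak symplectic manifolds).** All locally convex spaces are real and Hausdorff. A map $f$ from an open subset $U$ of a locally convex space $E$ to a locally convex space $F$ is *smooth* if it is continuous, all iterated directional derivatives $(\partial_{h_j}\cdots\partial_{h_1}f)(x)$ exist, and they define continuous maps $U\times E^j\to F$ for all $j\ge 1$. Smooth manifolds modeled on a locally convex space, their tangent bundles and smooth vector fields are defined from this as usual; a $p$-form is a smooth function on the $p$-fold Whitney sum $T(M)^{\oplus p}$ that is alternating and $p$-linear on the fibers. Let $M$ be a smooth manifold modeled on a locally convex space and let $\omega$ be a closed $2$-form on $M$ which is non-degenerate in the sense that, for every $m\in M$ and $v\in T_m(M)$, $\omega_m(v,\cdot)=0$ implies $v=0$. Let $\mathcal V(M)$ denote the space of smooth vector fields on $M$. Then $$\mathcal A:=\{H\in C^\infty(M,\mathbb R) : (\exists X_H\in\mathcal V(M))\ \mathrm dH=i_{X_H}\omega\},\qquad i_X\omega:=\omega(X,\cdot),$$ is a unital subalgebra of $C^\infty(M,\mathbb R)$, and $$\{F,G\}:=\omega(X_F,X_G)=\mathrm dF(X_G)=X_GF$$ is a well-defined (independent of the choice of $X_F,X_G$)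 bilinear map $\mathcal A\times\mathcal A\to\mathcal A$ satisfying: * (P1) it is a Poisson bracket: for all $F,G,H\in\mathcal A$, $\{F,G\}=-\{G,F\}$, $\{F,\{G,H\}\}=\{\{F,G\},H\}+\{G,\{F,H\}\}$ and $\{F,GH\}=\{F,G\}H+G\{F,H\}$; * (P3) for every $H\in\mathcal A$ there is a smooth vector field $X_H\in\mathcal V(M)$ with $X_HF=\{F,H\}$ for all $F\in\mathcal A$. Let $\mathrm{ham}(M,\omega):=\{X\in\mathcal V(M) : (\exists H\in C^\infty(M,\mathbb R))\ i_X\omega=\mathrm dH\}$. If, in addition, for every $m\in M$ and $v\in T_m(M)$, the condition that $\omega_m(X(m),v)=0$ for every $X\in\mathrm{ham}(M,\omega)$ implies $v=0$, then also * (P2) for every $m\in M$ and $v\in T_m(M)$ such that $\mathrm dF(m)v=0$ for every $F\in\mathcal A$, we have $v=0$. -/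

import Mathlib

open Filter Topology Set

noncomputable section

namespace LocConvex

/-! ### Differential calculus on locally convex spaces -/

section Calculus

variable {E F : Type*} [AddCommGroup E] [Module ℝ E] [TopologicalSpace E]
  [AddCommGroup F] [Module ℝ F] [TopologicalSpace F]

/-- `f` has the derivative `l` at `x` in the direction `h`:
`l = lim_{t → 0} (f (x + t h) - f x) / t`. -/
def HasDirDerivAt (f : E → F) (l : F) (x h : E) : Prop :=
  Tendsto (fun t : ℝ => t⁻¹ • (f (x + t • h) - f x)) (𝓝[≠] 0) (𝓝 l)

/-- The directional derivative `df(x)(h) = lim_{t → 0} (f (x + t h) - f x) / t`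
(only meaningful where the limit exists). -/
def dirDeriv (f : E → F) (x h : E) : F :=
  limUnder (𝓝[≠] (0 : ℝ)) (fun t : ℝ => t⁻¹ • (f (x + t • h) - f x))

/-- `f` is smooth on the open set `U`: the iterated directional derivatives
`D j x (h₁, …, hⱼ) = (∂_{hⱼ} ⋯ ∂_{h₁} f)(x)` of all orders exist at the points of `U`, and each
`D j : U × E^j → F` is continuous (for `j = 0` this is the continuity of `f` on `U`). -/
def SmoothOn (f : E → F) (U : Set E) : Prop :=
  ∃ D : (j : ℕ) → E → (Fin j → E) → F,
    (∀ x ∈ U, ∀ h : Fin 0 → E, D 0 x h = f x) ∧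
    (∀ (j : ℕ), ∀ x ∈ U, ∀ h : Fin (j + 1) → E,
      HasDirDerivAt (fun y => D j y (Fin.init h)) (D (j + 1) x h) x (h (Fin.last j))) ∧
    (∀ j : ℕ, ContinuousOn (fun q : E × (Fin j → E) => D j q.1 q.2) (U ×ˢ univ))

end Calculus

/-! ### Manifolds modeled on a locally convex space -/

/-- The charted space `M` modeled on `E` is a smooth manifold: all changes of charts
`e' ∘ e⁻¹ : e(dom e ∩ dom e') → E` are smooth. -/
class SmoothManifold (E : Type*) [AddCommGroup E] [Module ℝ E] [TopologicalSpace E]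
    (M : Type*) [TopologicalSpace M] [ChartedSpace E M] : Prop where
  smooth_transition : ∀ e ∈ atlas E M, ∀ e' ∈ atlas E M,
    SmoothOn (fun y => e' (e.symm y)) (e.target ∩ e.symm ⁻¹' e'.source)

/-- The tangent space `T_p(M)`: a tangent vector at `p` is given by its coordinate
vector in the preferred chart `chartAt E p` at `p`. -/
abbrev TSpace (E : Type*) {M : Type*} (_p : M) : Type _ := E

section Manifold

variable {E : Type*} [AddCommGroup E] [Module ℝ E] [TopologicalSpace E]
  {M : Type*} [TopologicalSpace M] [ChartedSpace E M]

/-- The coordinates, in a chart `e` around `p`, of a tangent vector `v ∈ T_p(M)`. -/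
def toCoord (e : OpenPartialHomeomorph M E) (p : M) (v : TSpace E p) : E :=
  dirDeriv (fun y => e ((chartAt E p).symm y)) (chartAt E p p) v

/-- The tangent vector at `p` whose coordinates in a chart `e` around `p` are `v`. -/
def ofCoord (e : OpenPartialHomeomorph M E) (p : M) (v : E) : TSpace E p :=
  dirDeriv (fun y => chartAt E p (e.symm y)) (e p) v

variable (E) in
/-- `H` belongs to `C^∞(M)`. -/
def SmoothFun (H : M → ℝ) : Prop :=
  ∀ e ∈ atlas E M, SmoothOn (fun y => H (e.symm y)) e.target

/-- The differential `dH(p)` applied to `v ∈ T_p(M)`. -/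
def diff (H : M → ℝ) (p : M) (v : TSpace E p) : ℝ :=
  dirDeriv (fun y => H ((chartAt E p).symm y)) (chartAt E p p) v

/-- The vector field `X` is smooth: its coordinate expression in every chart is smooth. -/
def SmoothVF (X : (p : M) → TSpace E p) : Prop :=
  ∀ e ∈ atlas E M, SmoothOn (fun y => toCoord e (e.symm y) (X (e.symm y))) e.target

variable (E M) in
/-- A smooth differential `2`-form on `M`: alternating bilinear forms `ω_p` on the tangent spaces
that fit together to a smooth function on `T(M) ⊕ T(M)`; smoothness is expressed
in the charts `e.target × E × E` of that bundle. -/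
structure TwoForm where
  form : (p : M) → TSpace E p →ₗ[ℝ] TSpace E p →ₗ[ℝ] ℝ
  alternating : ∀ (p : M) (v : TSpace E p), form p v v = 0
  smooth : ∀ e ∈ atlas E M,
    SmoothOn (fun q : E × E × E =>
      form (e.symm q.1) (ofCoord e (e.symm q.1) q.2.1) (ofCoord e (e.symm q.1) q.2.2))
      (e.target ×ˢ univ)

namespace TwoForm

/-- The coordinate expression `ω_e(y)(v, w)` of the form in a chart `e`. -/
def inChart (ω : TwoForm E M) (e : OpenPartialHomeomorph M E) (y v w : E) : ℝ :=
  ω.form (e.symm y) (ofCoord e (e.symm y) v) (ofCoord e (e.symm y) w)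

/-- `dω = 0`, where in a chart
`dω(u, v, w) = ∂_u (ω(v, w)) - ∂_v (ω(u, w)) + ∂_w (ω(u, v))` for constant `u, v, w`. -/
def Closed (ω : TwoForm E M) : Prop :=
  ∀ e ∈ atlas E M, ∀ y ∈ e.target, ∀ u v w : E,
    dirDeriv (fun z => ω.inChart e z v w) y u - dirDeriv (fun z => ω.inChart e z u w) y v
      + dirDeriv (fun z => ω.inChart e z u v) y w = 0

/-- Every `ω_p` is non-degenerate (weakly: `v ↦ ω_p(v, ·)` is injective). -/
def Nondegenerate (ω : TwoForm E M) : Prop :=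
  ∀ (p : M) (v : TSpace E p), (∀ w : TSpace E p, ω.form p v w = 0) → v = 0

/-- `X` is a smooth vector field with `dH = i_X ω`. -/
def IsHamiltonianVF (ω : TwoForm E M) (H : M → ℝ) (X : (p : M) → TSpace E p) : Prop :=
  SmoothVF X ∧ ∀ (p : M) (v : TSpace E p), diff H p v = ω.form p (X p) v

/-- The smooth functions `H` that admit a smooth vector field `X_H` with `dH = i_{X_H} ω`. -/
def admissible (ω : TwoForm E M) : Set (M → ℝ) :=
  {H | SmoothFun E H ∧ ∃ X : (p : M) → TSpace E p, ω.IsHamiltonianVF H X}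

/-- The set `ham(M, ω)` of Hamiltonian vector fields. -/
def ham (ω : TwoForm E M) : Set ((p : M) → TSpace E p) :=
  {X | ∃ H : M → ℝ, SmoothFun E H ∧ ω.IsHamiltonianVF H X}

end TwoForm

/-! ### The axioms of a weak Poisson structure -/

/-- A Poisson bracket on a commutative algebra: a Lie bracket (bilinearity is in the type)
that satisfies the Leibniz rule. -/
structure IsPoissonBracket {A : Type*} [CommRing A] [Algebra ℝ A]
    (br : A →ₗ[ℝ] A →ₗ[ℝ] A) : Prop where
  skew : ∀ F G : A, br F G = -br G F
  jacobi : ∀ F G H : A, br F (br G H) = br (br F G) H + br G (br F H)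
  leibniz : ∀ F G H : A, br F (G * H) = br F G * H + G * br F H

variable (E) in
/-- The differentials of the elements of `A` separate the tangent vectors. -/
def SeparatesTangent (A : Subalgebra ℝ (M → ℝ)) : Prop :=
  ∀ (m : M) (v : TSpace E m), (∀ F ∈ A, diff F m v = 0) → v = 0

variable (E) in
/-- Every `H ∈ A` has a smooth vector field `X_H` with `X_H F = {F, H}` for all `F ∈ A`,
where `(X F)(p) = dF(p) X(p)`. -/
def HasHamiltonianVF (A : Subalgebra ℝ (M → ℝ)) (br : A →ₗ[ℝ] A →ₗ[ℝ] A) : Prop :=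
  ∀ H : A, ∃ X : (p : M) → TSpace E p, SmoothVF X ∧
    ∀ (F : A) (p : M), diff (F : M → ℝ) p (X p) = (br F H : M → ℝ) p

end Manifold

end LocConvex

end

/-!
The differential calculus for `SmoothOn` is developed first. Since the derivatives in its definition
keep their directions fixed, maps of class `C^n` are also described inductively (`CkOn`): `f` is
`C^(n+1)` if it has a derivative `df : U × E → F` that is `C^n` in both arguments. The two notions
agree (`SmoothOn.ckOn`, `smoothOn_of_ckOn`), because iterated derivatives are multilinear. The
second one is stable under composition by induction on `n` (`CkOn.comp`). No completeness is
available, hence no integrals: all estimates come from the mean value theorem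
`slope_mem_of_hasDirDerivAt`, a consequence of the Hahn-Banach theorem.

In a chart, let `df = Ω(X, ·)` and `dg = Ω(Y, ·)`. Differentiating `Ω(X, Y)` by the product rule and
using the symmetry of the second derivatives of `f` and `g` together with `dΩ = 0` gives
`d(Ω(X, Y)) = Ω(dX(Y) - dY(X), ·)` (`LocalTwoForm.hasDirDerivAt_bracket`): the bracket of two
admissible functions is admissible in the chart. That the vector fields `dX(Y) - dY(X)` of different
charts agree needs no computation: by non-degeneracy they are determined by the differential of the
globally defined function `ω(X, Y)` (`TwoForm.IsHamiltonianVF.bracketVF`).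

As `{F, G} = X_G F`, the Jacobi identity says that the Hamiltonian vector field of `{G, H}` acts on
`F` as the commutator of those of `H` and `G`, which is again the symmetry of the second derivative
of `F` (`LocalTwoForm.apply_bracket`). The Leibniz rule is the one for differentials. Finally, `dH`
for admissible `H` is `ω(X, ·)` with `X` in `ham(M, ω)`, so the two separation conditions are the
same.
-/

set_option linter.unusedSectionVars false

namespace LocConvex

universe u v w

/-! ### Directional derivatives -/

section DirDeriv

variable {E : Type u} {F : Type v} {G : Type w}
  [AddCommGroup E] [Module ℝ E]
  [AddCommGroup F] [Module ℝ F] [TopologicalSpace F]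
  [AddCommGroup G] [Module ℝ G] [TopologicalSpace G]

theorem HasDirDerivAt.unique [T2Space F] {f : E → F} {l l' : F} {x h : E}
    (H : HasDirDerivAt f l x h) (H' : HasDirDerivAt f l' x h) : l = l' :=
  tendsto_nhds_unique H H'

theorem HasDirDerivAt.dirDeriv_eq [T2Space F] {f : E → F} {l : F} {x h : E}
    (H : HasDirDerivAt f l x h) : dirDeriv f x h = l :=
  H.limUnder_eq

theorem hasDirDerivAt_const (c : F) (x h : E) : HasDirDerivAt (fun _ : E => c) 0 x h := by
  simpa [HasDirDerivAt] using tendsto_const_nhds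

theorem hasDirDerivAt_zero (f : E → F) (x : E) : HasDirDerivAt f 0 x 0 := by
  simpa [HasDirDerivAt] using tendsto_const_nhds

theorem HasDirDerivAt.prodMk {f : E → F} {g : E → G} {l : F} {m : G} {x h : E}
    (hf : HasDirDerivAt f l x h) (hg : HasDirDerivAt g m x h) :
    HasDirDerivAt (fun y => (f y, g y)) (l, m) x h :=
  Tendsto.prodMk_nhds hf hg

theorem hasDirDerivAt_clm [TopologicalSpace E] (L : E →L[ℝ] F) (x h : E) :
    HasDirDerivAt L (L h) x h := by
  refine tendsto_const_nhds.congr' ?_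
  filter_upwards [self_mem_nhdsWithin] with t ht
  simp [smul_smul, inv_mul_cancel₀ (show t ≠ 0 from ht)]

theorem tendsto_add_smul [TopologicalSpace E] [ContinuousAdd E] [ContinuousSMul ℝ E] (x h : E) :
    Tendsto (fun t : ℝ => x + t • h) (𝓝[≠] 0) (𝓝 x) := by
  have : Tendsto (fun t : ℝ => x + t • h) (𝓝 0) (𝓝 (x + (0 : ℝ) • h)) :=
    Continuous.tendsto (by fun_prop) 0
  rw [zero_smul, add_zero] at this
  exact this.mono_left nhdsWithin_le_nhds

theorem HasDirDerivAt.congr_of_eventuallyEq [TopologicalSpace E] [ContinuousAdd E]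
    [ContinuousSMul ℝ E] {f g : E → F} {l : F} {x h : E}
    (H : HasDirDerivAt f l x h) (hfg : f =ᶠ[𝓝 x] g) : HasDirDerivAt g l x h := by
  refine Tendsto.congr' ?_ H
  filter_upwards [(tendsto_add_smul x h).eventually hfg] with t ht
  rw [ht, hfg.eq_of_nhds]

theorem dirDeriv_congr [TopologicalSpace E] [ContinuousAdd E] [ContinuousSMul ℝ E]
    {f g : E → F} {x : E} (hfg : f =ᶠ[𝓝 x] g) (h : E) : dirDeriv f x h = dirDeriv g x h := by
  unfold dirDeriv limUnder
  congr 1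
  refine Filter.map_congr ?_
  filter_upwards [(tendsto_add_smul x h).eventually hfg] with t ht
  rw [ht, hfg.eq_of_nhds]

theorem HasDirDerivAt.smul_dir [ContinuousConstSMul ℝ F] {f : E → F} {l : F} {x h : E}
    (H : HasDirDerivAt f l x h) (c : ℝ) : HasDirDerivAt f (c • l) x (c • h) := by
  rcases eq_or_ne c 0 with rfl | hc
  · simpa using hasDirDerivAt_zero f x
  have h1 : Tendsto (fun t : ℝ => t * c) (𝓝[≠] 0) (𝓝[≠] 0) := by
    refine tendsto_nhdsWithin_iff.2 ⟨?_, ?_⟩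
    · have : Tendsto (fun t : ℝ => t * c) (𝓝 0) (𝓝 (0 * c)) := Continuous.tendsto (by fun_prop) 0
      rw [zero_mul] at this
      exact this.mono_left nhdsWithin_le_nhds
    · filter_upwards [self_mem_nhdsWithin] with t ht
      exact mul_ne_zero ht hc
  refine ((Tendsto.comp H h1).const_smul c).congr fun t => ?_
  simp only [Function.comp, smul_smul, mul_inv]
  congr 1
  field_simp

theorem HasDirDerivAt.clm_comp {f : E → F} {l : F} {x h : E} (L : F →L[ℝ] G)
    (H : HasDirDerivAt f l x h) : HasDirDerivAt (fun y => L (f y)) (L l) x h := by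
  refine ((L.continuous.tendsto l).comp H).congr fun t => ?_
  simp

theorem HasDirDerivAt.add [ContinuousAdd F] {f g : E → F} {l m : F} {x h : E}
    (hf : HasDirDerivAt f l x h) (hg : HasDirDerivAt g m x h) :
    HasDirDerivAt (fun y => f y + g y) (l + m) x h := by
  refine (Tendsto.add hf hg).congr fun t => ?_
  module

theorem HasDirDerivAt.const_smul [ContinuousConstSMul ℝ F] {f : E → F} {l : F} {x h : E}
    (hf : HasDirDerivAt f l x h) (c : ℝ) :
    HasDirDerivAt (fun y => c • f y) (c • l) x h := by
  refine (Tendsto.const_smul hf c).congr fun t => ?_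
  rw [← smul_sub, smul_comm]

theorem HasDirDerivAt.neg [IsTopologicalAddGroup F] {f : E → F} {l : F} {x h : E}
    (hf : HasDirDerivAt f l x h) : HasDirDerivAt (fun y => -f y) (-l) x h := by
  refine (Tendsto.neg hf).congr fun t => ?_
  module

/-- The restriction of `f` to the line `r ↦ x + r h`, composed with a continuous functional, is
differentiable in the usual sense wherever `f` is in the direction `h`. -/
theorem HasDirDerivAt.hasDerivAt_line {f : E → F} {l : F} {x h : E} {r : ℝ}
    (H : HasDirDerivAt f l (x + r • h) h) (φ : F →L[ℝ] ℝ) :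
    HasDerivAt (fun s : ℝ => φ (f (x + s • h))) (φ l) r := by
  rw [hasDerivAt_iff_tendsto_slope_zero]
  refine (H.clm_comp φ).congr fun t => ?_
  rw [add_smul, add_assoc]

end DirDeriv

section MeanValue

variable {E : Type u} {F : Type v} [AddCommGroup E] [Module ℝ E]
  [AddCommGroup F] [Module ℝ F] [TopologicalSpace F] [IsTopologicalAddGroup F] [ContinuousSMul ℝ F]

/-- The mean value theorem: a difference quotient lies in every open convex set that contains the
derivatives along the segment. Otherwise a continuous functional would separate the two, against
the mean value theorem for real functions. -/
theorem slope_mem_of_hasDirDerivAt {f : E → F} {x h : E} {t : ℝ} (ht : t ≠ 0) {C : Set F}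
    (hC : Convex ℝ C) (hCo : IsOpen C)
    (H : ∀ s ∈ Icc (0 : ℝ) 1, ∃ l ∈ C, HasDirDerivAt f l (x + (s * t) • h) h) :
    t⁻¹ • (f (x + t • h) - f x) ∈ C := by
  by_contra hn
  obtain ⟨φ, hφ⟩ := geometric_hahn_banach_point_open hC hCo hn
  choose! l hlC hl using H
  have hd : ∀ s ∈ Icc (0 : ℝ) 1,
      HasDerivAt (fun s : ℝ => φ (f (x + (s * t) • h))) (φ (l s) * t) s := fun s hs =>
    HasDerivAt.comp (h₂ := fun r : ℝ => φ (f (x + r • h))) s ((hl s hs).hasDerivAt_line φ)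
      (by simpa using (hasDerivAt_id s).mul_const t)
  obtain ⟨s, hs, hs'⟩ := exists_hasDerivAt_eq_slope
    (fun s : ℝ => φ (f (x + (s * t) • h))) (fun s => φ (l s) * t) one_pos
    (fun s hs => (hd s hs).continuousAt.continuousWithinAt)
    (fun s hs => hd s (Ioo_subset_Icc_self hs))
  have hs2 := Ioo_subset_Icc_self hs
  have := hφ _ (hlC s hs2)
  simp only [one_mul, zero_mul, zero_smul, add_zero, sub_zero, div_one] at hs'
  rw [map_smul, map_sub, ← hs', smul_eq_mul] at this
  field_simp at this
  exact lt_irrefl _ this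

variable [TopologicalSpace E] [IsTopologicalAddGroup E] [ContinuousSMul ℝ E]
  [LocallyConvexSpace ℝ F]

/-- A continuous directional derivative is strict: difference quotients may be taken with
moving base points and moving directions. -/
theorem tendsto_slope {ι : Type*} {L : Filter ι} {f : E → F} {f' : E × E → F} {V : Set E}
    (hV : IsOpen V) (hf : ∀ x ∈ V, ∀ h, HasDirDerivAt f (f' (x, h)) x h)
    (hc : ContinuousOn f' (V ×ˢ univ)) {y k : E} (hy : y ∈ V) {t : ι → ℝ} {a b : ι → E}
    (ht : Tendsto t L (𝓝[≠] 0)) (ha : Tendsto a L (𝓝 y)) (hb : Tendsto b L (𝓝 k)) :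
    Tendsto (fun i => (t i)⁻¹ • (f (a i + t i • b i) - f (a i))) L (𝓝 (f' (y, k))) := by
  rw [tendsto_def]
  intro W hW
  obtain ⟨S, hS, hSc, hSW⟩ := (locallyConvexSpace_iff_exists_convex_subset ℝ F).1 ‹_› _ W hW
  have hN : ∀ᶠ q in 𝓝 (y, k), q.1 ∈ V ∧ f' q ∈ interior S := by
    have h1 : ∀ᶠ q : E × E in 𝓝 (y, k), q ∈ V ×ˢ (univ : Set E) :=
      (hV.prod isOpen_univ).mem_nhds ⟨hy, mem_univ _⟩
    have h2 := (hc.continuousAt ((hV.prod isOpen_univ).mem_nhds ⟨hy, mem_univ k⟩)).eventually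
      (isOpen_interior.mem_nhds (mem_interior_iff_mem_nhds.2 hS))
    filter_upwards [h1, h2] with q hq1 hq2 using ⟨hq1.1, hq2⟩
  -- The segments `a + [0, t] b` shrink to `y`, uniformly by compactness of `[0, 1]`.
  have hU : ∀ᶠ z : ℝ × E × E in 𝓝 (0, y, k), ∀ s ∈ Icc (0 : ℝ) 1,
      z.2.1 + (s * z.1) • z.2.2 ∈ V ∧
        f' (z.2.1 + (s * z.1) • z.2.2, z.2.2) ∈ interior S := by
    refine isCompact_Icc.eventually_forall_of_forall_eventually
      (P := fun (z : ℝ × E × E) (s : ℝ) => z.2.1 + (s * z.1) • z.2.2 ∈ V ∧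
        f' (z.2.1 + (s * z.1) • z.2.2, z.2.2) ∈ interior S) fun s _ => ?_
    have hcont : Tendsto (fun z : (ℝ × E × E) × ℝ =>
        (z.1.2.1 + (z.2 * z.1.1) • z.1.2.2, z.1.2.2)) (𝓝 ((0, y, k), s))
        (𝓝 (y + (s * 0) • k, k)) :=
      Continuous.tendsto (by fun_prop) ((0, y, k), s)
    rw [mul_zero, zero_smul, add_zero] at hcont
    exact hcont.eventually hN
  have ht0 := tendsto_nhdsWithin_iff.1 ht
  filter_upwards [(ht0.1.prodMk_nhds (ha.prodMk_nhds hb)).eventually hU, ht0.2] with i hi hti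
  exact hSW (interior_subset (slope_mem_of_hasDirDerivAt hti hSc.interior isOpen_interior
    fun s hs => ⟨_, (hi s hs).2, hf _ (hi s hs).1 _⟩))

/-- The chain rule, for an outer map with continuous directional derivatives. -/
theorem HasDirDerivAt.comp {D : Type w} [AddCommGroup D] [Module ℝ D] [TopologicalSpace D]
    {g : E → F} {g' : E × E → F} {V : Set E}
    (hV : IsOpen V) (hg : ∀ x ∈ V, ∀ h, HasDirDerivAt g (g' (x, h)) x h)
    (hc : ContinuousOn g' (V ×ˢ univ)) {f : D → E} {x h : D} {l : E} (hx : f x ∈ V)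
    (hf : HasDirDerivAt f l x h) : HasDirDerivAt (fun y => g (f y)) (g' (f x, l)) x h := by
  refine (tendsto_slope hV hg hc hx (t := fun t => t) tendsto_id tendsto_const_nhds hf).congr' ?_
  filter_upwards [self_mem_nhdsWithin] with t ht
  rw [smul_smul, mul_inv_cancel₀ (show t ≠ 0 from ht), one_smul, add_sub_cancel]

/-- A continuous directional derivative is linear in the direction. -/
theorem map_add_smul_of_hasDirDerivAt [T2Space F] {f : E → F} {f' : E × E → F} {V : Set E}
    (hV : IsOpen V) (hf : ∀ x ∈ V, ∀ h, HasDirDerivAt f (f' (x, h)) x h)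
    (hc : ContinuousOn f' (V ×ˢ univ)) {x : E} (hx : x ∈ V) (h k : E) (c : ℝ) :
    f' (x, h + c • k) = f' (x, h) + c • f' (x, k) := by
  have h1 := tendsto_slope hV hf hc hx (t := fun t => t) tendsto_id (tendsto_add_smul x h)
    (tendsto_const_nhds (x := c • k))
  have h2 := tendsto_slope hV hf hc hx (t := fun t => t) tendsto_id
    (tendsto_const_nhds (x := x)) (tendsto_const_nhds (x := h))
  have h3 : HasDirDerivAt f (f' (x, h) + f' (x, c • k)) x (h + c • k) := by
    refine (h2.add h1).congr fun t => ?_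
    rw [← smul_add, smul_add t h, ← add_assoc x]
    congr 1
    abel
  rw [(hf x hx _).unique h3, (hf x hx _).unique ((hf x hx k).smul_dir c)]

end MeanValue

/-! ### Maps of class `C^n` -/

section CkOn

/-- `f` is of class `C^n` on `U`: it is continuous there and, for `n > 0`, has a directional
derivative `f' : U × E → F` of class `C^(n-1)`. Compared with `SmoothOn`, all the arguments of `f'`
are differentiated, which makes the chain rule amenable to induction. -/
def CkOn : ℕ → ∀ {E : Type u} {F : Type v} [AddCommGroup E] [Module ℝ E] [TopologicalSpace E]
    [AddCommGroup F] [Module ℝ F] [TopologicalSpace F], (E → F) → Set E → Prop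
  | 0, _, _, _, _, _, _, _, _, f, U => ContinuousOn f U
  | n + 1, E, F, _, _, _, _, _, _, f, U => ContinuousOn f U ∧ ∃ f' : E × E → F,
      (∀ x ∈ U, ∀ h, HasDirDerivAt f (f' (x, h)) x h) ∧ CkOn n f' (U ×ˢ univ)

variable {E : Type u} {F : Type v} {G : Type w}
  [AddCommGroup E] [Module ℝ E] [TopologicalSpace E]
  [AddCommGroup F] [Module ℝ F] [TopologicalSpace F]
  [AddCommGroup G] [Module ℝ G] [TopologicalSpace G]

theorem CkOn.continuousOn {n : ℕ} {f : E → F} {U : Set E} (hf : CkOn n f U) :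
    ContinuousOn f U := by
  cases n with
  | zero => exact hf
  | succ n => exact hf.1

theorem CkOn.of_succ {n : ℕ} {f : E → F} {U : Set E} (hf : CkOn (n + 1) f U) : CkOn n f U := by
  induction n generalizing E F with
  | zero => exact hf.1
  | succ n ih =>
    obtain ⟨hc, f', hf', hn⟩ := hf
    exact ⟨hc, f', hf', ih hn⟩

theorem CkOn.clm (n : ℕ) (L : E →L[ℝ] F) (U : Set E) : CkOn n L U := by
  induction n generalizing E F with
  | zero => exact L.continuous.continuousOn
  | succ n ih =>
    exact ⟨L.continuous.continuousOn, L.comp (ContinuousLinearMap.snd ℝ E E),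
      fun x _ h => hasDirDerivAt_clm L x h, ih _ _⟩

theorem CkOn.const (n : ℕ) (c : F) (U : Set E) : CkOn n (fun _ : E => c) U := by
  induction n generalizing E F with
  | zero => exact continuousOn_const
  | succ n ih =>
    exact ⟨continuousOn_const, fun _ => 0, fun x _ h => hasDirDerivAt_const c x h, ih _ _⟩

theorem CkOn.prodMk {n : ℕ} {f : E → F} {g : E → G} {U : Set E} (hf : CkOn n f U)
    (hg : CkOn n g U) : CkOn n (fun x => (f x, g x)) U := by
  induction n generalizing E F G with
  | zero => exact ContinuousOn.prodMk hf hg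
  | succ n ih =>
    obtain ⟨hc, f', hf', hn⟩ := hf
    obtain ⟨hc2, g', hg', hn2⟩ := hg
    exact ⟨hc.prodMk hc2, _, fun x hx h => (hf' x hx h).prodMk (hg' x hx h), ih hn hn2⟩

theorem CkOn.comp_clm {n : ℕ} {g : F → G} {V : Set F} (hg : CkOn n g V) (L : E →L[ℝ] F)
    {U : Set E} (hL : MapsTo L U V) : CkOn n (fun x => g (L x)) U := by
  induction n generalizing E F G with
  | zero => exact ContinuousOn.comp hg L.continuous.continuousOn hL
  | succ n ih =>
    obtain ⟨hc, g', hg', hn⟩ := hg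
    refine ⟨hc.comp L.continuous.continuousOn hL, _, fun x hx h => ?_,
      ih hn (L.prodMap L) fun q hq => ⟨hL hq.1, mem_univ _⟩⟩
    refine (hg' (L x) (hL hx) (L h)).congr fun t => ?_
    simp only [map_add, map_smul]

section

variable [IsTopologicalAddGroup E] [ContinuousSMul ℝ E]

theorem CkOn.congr {n : ℕ} {f g : E → F} {U : Set E} (hU : IsOpen U) (hf : CkOn n f U)
    (h : ∀ x ∈ U, g x = f x) : CkOn n g U := by
  cases n with
  | zero => exact ContinuousOn.congr hf h
  | succ n =>
    obtain ⟨hc, f', hf', hn⟩ := hf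
    exact ⟨hc.congr h, f', fun x hx k => (hf' x hx k).congr_of_eventuallyEq
      (by filter_upwards [hU.mem_nhds hx] with y hy using (h y hy).symm), hn⟩

end

section

variable [IsTopologicalAddGroup E] [ContinuousSMul ℝ E] [LocallyConvexSpace ℝ E]
  [IsTopologicalAddGroup F] [ContinuousSMul ℝ F] [LocallyConvexSpace ℝ F]
  [IsTopologicalAddGroup G] [ContinuousSMul ℝ G] [LocallyConvexSpace ℝ G]

/-- The chain rule: `d(g ∘ f)(x, h) = dg(f x, df(x, h))` is again a composition, of `dg` with a
map built from `f` and `df`, so that induction on `n` applies. -/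
theorem CkOn.comp {n : ℕ} {g : F → G} {f : E → F} {U : Set E} {V : Set F} (hU : IsOpen U)
    (hV : IsOpen V) (hg : CkOn n g V) (hf : CkOn n f U) (hfU : MapsTo f U V) :
    CkOn n (fun x => g (f x)) U := by
  induction n generalizing E F G with
  | zero => exact ContinuousOn.comp hg hf hfU
  | succ n ih =>
    have hfs := hf.of_succ
    obtain ⟨hc, f', hf', hn⟩ := hf
    obtain ⟨hc2, g', hg', hn2⟩ := hg
    refine ⟨hc2.comp hc hfU, fun q => g' (f q.1, f' q), fun x hx h =>
      HasDirDerivAt.comp hV hg' hn2.continuousOn (hfU hx) (hf' x hx h), ?_⟩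
    have h1 : CkOn n (fun q : E × E => f q.1) (U ×ˢ univ) :=
      hfs.comp_clm (ContinuousLinearMap.fst ℝ E E) fun q hq => hq.1
    exact ih (hU.prod isOpen_univ) (hV.prod isOpen_univ) hn2 (h1.prodMk hn)
      fun q hq => ⟨hfU hq.1, mem_univ _⟩

theorem CkOn.clm_comp {n : ℕ} {f : E → F} {U : Set E} (hU : IsOpen U) (L : F →L[ℝ] G)
    (hf : CkOn n f U) : CkOn n (fun x => L (f x)) U :=
  CkOn.comp hU isOpen_univ (CkOn.clm n L univ) hf fun _ _ => mem_univ _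

theorem CkOn.add {n : ℕ} {f g : E → F} {U : Set E} (hU : IsOpen U) (hf : CkOn n f U)
    (hg : CkOn n g U) : CkOn n (fun x => f x + g x) U :=
  CkOn.clm_comp hU (ContinuousLinearMap.fst ℝ F F + ContinuousLinearMap.snd ℝ F F)
    (hf.prodMk hg)

theorem CkOn.sub {n : ℕ} {f g : E → F} {U : Set E} (hU : IsOpen U) (hf : CkOn n f U)
    (hg : CkOn n g U) : CkOn n (fun x => f x - g x) U :=
  CkOn.clm_comp hU (ContinuousLinearMap.fst ℝ F F - ContinuousLinearMap.snd ℝ F F)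
    (hf.prodMk hg)

theorem CkOn.sum {n : ℕ} {ι : Type*} (s : Finset ι) {f : ι → E → F} {U : Set E} (hU : IsOpen U)
    (hf : ∀ i ∈ s, CkOn n (f i) U) : CkOn n (fun x => ∑ i ∈ s, f i x) U := by
  classical
  induction s using Finset.induction_on with
  | empty => simpa using CkOn.const n (0 : F) U
  | insert a s ha ih =>
    simp only [Finset.sum_insert ha]
    exact CkOn.add hU (hf a (by simp)) (ih fun i hi => hf i (by simp [hi]))

theorem hasDirDerivAt_smul (q k : ℝ × F) :
    HasDirDerivAt (fun q : ℝ × F => q.1 • q.2) (k.1 • q.2 + q.1 • k.2) q k := by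
  have h1 : Tendsto (fun t : ℝ => k.1 • q.2 + q.1 • k.2 + t • (k.1 • k.2)) (𝓝 0)
      (𝓝 (k.1 • q.2 + q.1 • k.2 + (0 : ℝ) • (k.1 • k.2))) :=
    Continuous.tendsto (by fun_prop) 0
  rw [zero_smul, add_zero] at h1
  refine (h1.mono_left nhdsWithin_le_nhds).congr' ?_
  filter_upwards [self_mem_nhdsWithin] with t ht
  rw [eq_inv_smul_iff₀ (show t ≠ 0 from ht)]
  simp only [Prod.fst_add, Prod.smul_fst, Prod.snd_add, Prod.smul_snd, smul_eq_mul]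
  module

theorem ckOn_smul (n : ℕ) : CkOn n (fun q : ℝ × F => q.1 • q.2) univ := by
  induction n with
  | zero => exact continuous_smul.continuousOn
  | succ n ih =>
    refine ⟨continuous_smul.continuousOn, fun q => q.2.1 • q.1.2 + q.1.1 • q.2.2,
      fun q _ k => hasDirDerivAt_smul q k, ?_⟩
    rw [univ_prod_univ]
    refine CkOn.add isOpen_univ ?_ ?_
    · exact CkOn.comp_clm ih
        (((ContinuousLinearMap.fst ℝ ℝ F).comp (ContinuousLinearMap.snd ℝ (ℝ × F) (ℝ × F))).prod
        ((ContinuousLinearMap.snd ℝ ℝ F).comp (ContinuousLinearMap.fst ℝ (ℝ × F) (ℝ × F))))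
        (mapsTo_univ _ _)
    · exact CkOn.comp_clm ih
        (((ContinuousLinearMap.fst ℝ ℝ F).comp (ContinuousLinearMap.fst ℝ (ℝ × F) (ℝ × F))).prod
        ((ContinuousLinearMap.snd ℝ ℝ F).comp (ContinuousLinearMap.snd ℝ (ℝ × F) (ℝ × F))))
        (mapsTo_univ _ _)

theorem CkOn.smul {n : ℕ} {c : E → ℝ} {f : E → F} {U : Set E} (hU : IsOpen U) (hc : CkOn n c U)
    (hf : CkOn n f U) : CkOn n (fun x => c x • f x) U :=
  CkOn.comp hU isOpen_univ (ckOn_smul n) (hc.prodMk hf) fun _ _ => mem_univ _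

theorem CkOn.hasDirDerivAt [T2Space F] {f : E → F} {U : Set E} {n : ℕ} (hf : CkOn (n + 1) f U)
    {x : E} (hx : x ∈ U) (h : E) : HasDirDerivAt f (dirDeriv f x h) x h := by
  obtain ⟨_, f', hf', _⟩ := hf
  rw [(hf' x hx h).dirDeriv_eq]
  exact hf' x hx h

theorem CkOn.dirDeriv [T2Space F] {f : E → F} {U : Set E} (hU : IsOpen U) {n : ℕ}
    (hf : CkOn (n + 1) f U) : CkOn n (fun q : E × E => dirDeriv f q.1 q.2) (U ×ˢ univ) := by
  obtain ⟨_, f', hf', hn⟩ := hf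
  exact hn.congr (hU.prod isOpen_univ) fun q hq => (hf' q.1 hq.1 q.2).dirDeriv_eq

theorem CkOn.dirDeriv_add_smul [T2Space F] {f : E → F} {U : Set E} (hU : IsOpen U) {n : ℕ}
    (hf : CkOn (n + 1) f U) {x : E} (hx : x ∈ U) (h k : E) (c : ℝ) :
    LocConvex.dirDeriv f x (h + c • k)
      = LocConvex.dirDeriv f x h + c • LocConvex.dirDeriv f x k :=
  map_add_smul_of_hasDirDerivAt (f' := fun q => LocConvex.dirDeriv f q.1 q.2) hU
    (fun _ hx h => hf.hasDirDerivAt hx h) (hf.dirDeriv hU).continuousOn hx h k c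

theorem CkOn.hasDirDerivAt_comp [T2Space G] {g : F → G} {V : Set F} (hV : IsOpen V) {n : ℕ}
    (hg : CkOn (n + 1) g V) {f : E → F} {x h : E} {l : F} (hx : f x ∈ V)
    (hf : HasDirDerivAt f l x h) :
    HasDirDerivAt (fun y => g (f y)) (LocConvex.dirDeriv g (f x) l) x h :=
  HasDirDerivAt.comp (g' := fun q => LocConvex.dirDeriv g q.1 q.2) hV
    (fun _ hx h => hg.hasDirDerivAt hx h) (hg.dirDeriv hV).continuousOn hx hf

end

end CkOn

/-! ### Smooth maps are the maps of class `C^n` for all `n` -/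

section Smooth

variable {E : Type u} {F : Type v}
  [AddCommGroup E] [Module ℝ E] [TopologicalSpace E]
  [IsTopologicalAddGroup E] [ContinuousSMul ℝ E] [LocallyConvexSpace ℝ E]
  [AddCommGroup F] [Module ℝ F] [TopologicalSpace F]
  [IsTopologicalAddGroup F] [ContinuousSMul ℝ F] [LocallyConvexSpace ℝ F] [T2Space F]

/-- Iterated directional derivatives are linear in each direction: in the last one as derivatives
of `C^1` maps, in the others by differentiating the linearity of the derivative of lower order. -/
theorem iterated_add_smul {U : Set E} (hU : IsOpen U) {D : (j : ℕ) → E → (Fin j → E) → F}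
    (hD : ∀ (j : ℕ), ∀ x ∈ U, ∀ h : Fin (j + 1) → E,
      HasDirDerivAt (fun y => D j y (Fin.init h)) (D (j + 1) x h) x (h (Fin.last j)))
    (hc : ∀ j : ℕ, ContinuousOn (fun q : E × (Fin j → E) => D j q.1 q.2) (U ×ˢ univ))
    (j : ℕ) {x : E} (hx : x ∈ U) (h : Fin j → E) (i : Fin j) (a b : E) (c : ℝ) :
    D j x (Function.update h i (a + c • b))
      = D j x (Function.update h i a) + c • D j x (Function.update h i b) := by
  induction j generalizing x with
  | zero => exact i.elim0
  | succ j ih =>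
    induction i using Fin.lastCases with
    | last =>
      have key : ∀ z, Function.update h (Fin.last j) z
          = Fin.snoc (α := fun _ => E) (Fin.init h) z := fun z => by
        conv_lhs => rw [← Fin.snoc_init_self h]
        rw [Fin.update_snoc_last]
      simp only [key]
      refine map_add_smul_of_hasDirDerivAt (f := fun y => D j y (Fin.init h))
        (f' := fun q => D (j + 1) q.1 (Fin.snoc (α := fun _ => E) (Fin.init h) q.2)) hU
        (fun y hy z => ?_) ?_ hx a b c
      · simpa using hD j y hy (Fin.snoc (α := fun _ => E) (Fin.init h) z)
      · refine (hc (j + 1)).comp (f := fun q : E × E =>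
          (q.1, (Fin.snoc (α := fun _ => E) (Fin.init h) q.2 : Fin (j + 1) → E))) ?_
          fun q hq => ⟨hq.1, mem_univ _⟩
        exact (continuous_fst.prodMk
          (Continuous.finSnoc (A := fun _ => E) continuous_const continuous_snd)).continuousOn
    | cast i =>
      have hd : ∀ z, HasDirDerivAt (fun y => D j y (Function.update (Fin.init h) i z))
          (D (j + 1) x (Function.update h i.castSucc z)) x (h (Fin.last j)) := fun z => by
        have := hD j x hx (Function.update h i.castSucc z)
        rwa [Fin.init_update_castSucc,
          Function.update_of_ne (Fin.castSucc_lt_last i).ne'] at this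
      refine (hd _).unique (((hd a).add ((hd b).const_smul c)).congr_of_eventuallyEq ?_)
      filter_upwards [hU.mem_nhds hx] with y hy using (ih hy _ i).symm

/-- The iterated directional derivatives of a smooth map are of class `C^n` in all the variables.
The derivative of `D j` at `(x, h)` in the direction `(u, k)` is
`D (j + 1) x (h, u) + ∑ i, D j x (h₁, …, kᵢ, …, hⱼ)`. -/
theorem ckOn_iterated {U : Set E} (hU : IsOpen U) {D : (j : ℕ) → E → (Fin j → E) → F}
    (hD : ∀ (j : ℕ), ∀ x ∈ U, ∀ h : Fin (j + 1) → E,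
      HasDirDerivAt (fun y => D j y (Fin.init h)) (D (j + 1) x h) x (h (Fin.last j)))
    (hc : ∀ j : ℕ, ContinuousOn (fun q : E × (Fin j → E) => D j q.1 q.2) (U ×ˢ univ))
    (n j : ℕ) : CkOn n (fun q : E × (Fin j → E) => D j q.1 q.2) (U ×ˢ univ) := by
  have hUo : ∀ j, IsOpen (U ×ˢ (univ : Set (Fin j → E))) := fun j => hU.prod isOpen_univ
  induction n generalizing j with
  | zero => exact hc j
  | succ n ih =>
    refine ⟨hc j, fun q => D (j + 1) q.1.1 (Fin.snoc (α := fun _ => E) q.1.2 q.2.1)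
      + ∑ i, D j q.1.1 (Function.update q.1.2 i (q.2.2 i)), ?_, ?_⟩
    · rintro ⟨x, h⟩ ⟨hx, -⟩ ⟨u, k⟩
      -- The points between `h` and `h + t k` reached by moving one coordinate at a time.
      let p : ℝ → ℕ → Fin j → E := fun t m i => if (i : ℕ) < m then h i + t • k i else h i
      have hp : ∀ t (i : Fin j), p t (i + 1) = Function.update (p t i) i (h i + t • k i) ∧
          p t i = Function.update (p t i) i (h i) := fun t i => by
        constructor
        · ext l
          rcases eq_or_ne l i with rfl | hl
          · simp [p]
          · have : (l : ℕ) ≠ i := fun e => hl (Fin.ext e)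
            have h2 : (l : ℕ) < i + 1 ↔ (l : ℕ) < i := by omega
            simp [p, hl, h2]
        · simp [p]
      have hpl : ∀ (m : ℕ), Tendsto (fun t => p t m) (𝓝[≠] 0) (𝓝 h) := fun m => by
        rw [tendsto_pi_nhds]
        intro i
        by_cases him : (i : ℕ) < m
        · simpa [p, him] using tendsto_add_smul (h i) (k i)
        · simpa [p, him] using tendsto_const_nhds
      have hsum : ∀ t : ℝ, x + t • u ∈ U → D j (x + t • u) (h + t • k) - D j (x + t • u) h
          = t • ∑ i : Fin j, D j (x + t • u) (Function.update (p t i) i (k i)) := fun t ht => by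
        have h1 : p t j = h + t • k := by ext i; simp [p]
        have h0 : p t 0 = h := by ext i; simp [p]
        rw [Finset.smul_sum]
        conv_lhs => rw [← h1, ← h0]
        rw [← Finset.sum_range_sub (fun m => D j (x + t • u) (p t m)),
          ← Fin.sum_univ_eq_sum_range
            (fun m => D j (x + t • u) (p t (m + 1)) - D j (x + t • u) (p t m))]
        refine Finset.sum_congr rfl fun i _ => ?_
        rw [sub_eq_iff_eq_add, (hp t i).1, iterated_add_smul hU hD hc j ht, ← (hp t i).2, add_comm]
      have hl1 : HasDirDerivAt (fun y => D j y h)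
          (D (j + 1) x (Fin.snoc (α := fun _ => E) h u)) x u := by
        simpa using hD j x hx (Fin.snoc (α := fun _ => E) h u)
      have hl2 : Tendsto (fun t : ℝ => ∑ i : Fin j,
          D j (x + t • u) (Function.update (p t i) i (k i))) (𝓝[≠] 0)
          (𝓝 (∑ i, D j x (Function.update h i (k i)))) := by
        refine tendsto_finsetSum _ fun i _ => ?_
        exact ((hc j).continuousAt (x := (x, Function.update h i (k i)))
          ((hUo j).mem_nhds ⟨hx, mem_univ _⟩)).tendsto.comp
            ((tendsto_add_smul x u).prodMk_nhds ((hpl i).update i tendsto_const_nhds))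
      refine (Tendsto.add hl1 hl2).congr' ?_
      filter_upwards [self_mem_nhdsWithin, (tendsto_add_smul x u).eventually (hU.mem_nhds hx)]
        with t ht htU
      rw [eq_inv_smul_iff₀ (show t ≠ 0 from ht), smul_add, ← hsum t htU,
        smul_inv_smul₀ (show t ≠ 0 from ht)]
      simp
    · have hUo' := (hUo j).prod (isOpen_univ (X := E × (Fin j → E)))
      refine CkOn.add hUo' ?_ (CkOn.sum _ hUo' fun i _ => ?_)
      · let L : (E × (Fin j → E)) × (E × (Fin j → E)) →L[ℝ] E × (Fin (j + 1) → E) :=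
          { toFun := fun q => (q.1.1, Fin.snoc (α := fun _ => E) q.1.2 q.2.1)
            map_add' := fun q r => Prod.ext rfl <| funext fun l => by
              induction l using Fin.lastCases <;> simp
            map_smul' := fun c q => Prod.ext rfl <| funext fun l => by
              induction l using Fin.lastCases <;> simp
            cont := (by fun_prop : Continuous fun q : (E × (Fin j → E)) × (E × (Fin j → E)) =>
              q.1.1).prodMk (Continuous.finSnoc (by fun_prop) (by fun_prop)) }
        exact (ih (j + 1)).comp_clm L fun q hq => ⟨hq.1.1, mem_univ _⟩
      · let L : (E × (Fin j → E)) × (E × (Fin j → E)) →L[ℝ] E × (Fin j → E) :=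
          { toFun := fun q => (q.1.1, Function.update q.1.2 i (q.2.2 i))
            map_add' := fun q r => Prod.ext rfl <| funext fun l => by
              rcases eq_or_ne l i with rfl | hl <;> simp [*]
            map_smul' := fun c q => Prod.ext rfl <| funext fun l => by
              rcases eq_or_ne l i with rfl | hl <;> simp [*]
            cont := (by fun_prop : Continuous fun q : (E × (Fin j → E)) × (E × (Fin j → E)) =>
              q.1.1).prodMk (Continuous.update (by fun_prop) i (by fun_prop)) }
        exact (ih j).comp_clm L fun q hq => ⟨hq.1.1, mem_univ _⟩

theorem SmoothOn.ckOn {f : E → F} {U : Set E} (hU : IsOpen U) (hf : SmoothOn f U) (n : ℕ) :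
    CkOn n f U := by
  obtain ⟨D, h0, hD, hc⟩ := hf
  have h1 : CkOn n (fun x => D 0 x 0) U :=
    (ckOn_iterated hU hD hc n 0).comp_clm
      (ContinuousLinearMap.inl ℝ E (Fin 0 → E)) fun x hx => ⟨hx, mem_univ _⟩
  exact h1.congr hU fun x hx => (h0 x hx 0).symm

/-- The iterated directional derivatives `(∂_{hⱼ} ⋯ ∂_{h₁} f)(x)`. -/
noncomputable def iteratedDirDeriv (f : E → F) : (j : ℕ) → E → (Fin j → E) → F
  | 0, x, _ => f x
  | j + 1, x, h => dirDeriv (fun y => iteratedDirDeriv f j y (Fin.init h)) x (h (Fin.last j))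

theorem smoothOn_of_ckOn {f : E → F} {U : Set E} (hU : IsOpen U) (hf : ∀ n, CkOn n f U) :
    SmoothOn f U := by
  have hUo : ∀ j, IsOpen (U ×ˢ (univ : Set (Fin j → E))) := fun j => hU.prod isOpen_univ
  have key : ∀ j n, CkOn n (fun q : E × (Fin j → E) => iteratedDirDeriv f j q.1 q.2)
      (U ×ˢ univ) := by
    intro j
    induction j with
    | zero =>
      exact fun n => (hf n).comp_clm (ContinuousLinearMap.fst ℝ E (Fin 0 → E))
        fun q hq => hq.1
    | succ j ih =>
      intro n
      let L : E × (Fin (j + 1) → E) →L[ℝ] (E × (Fin j → E)) × (E × (Fin j → E)) :=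
        { toFun := fun q => ((q.1, Fin.init q.2), (q.2 (Fin.last j), 0))
          map_add' := fun q r => by ext <;> simp [Fin.init]
          map_smul' := fun c q => by ext <;> simp [Fin.init]
          cont := by simp only [Fin.init_def]; fun_prop }
      refine (((ih (n + 1)).dirDeriv (hUo j)).comp_clm L
        fun q hq => ⟨⟨hq.1, mem_univ _⟩, mem_univ _⟩).congr (hUo (j + 1))
        fun q hq => ?_
      simp [L, iteratedDirDeriv, LocConvex.dirDeriv]
  refine ⟨iteratedDirDeriv f, fun _ _ _ => rfl, fun j x hx h => ?_,
    fun j => (key j 0).continuousOn⟩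
  have := (key j 1).hasDirDerivAt (x := (x, Fin.init h)) ⟨hx, mem_univ _⟩ (h (Fin.last j), 0)
  simpa [iteratedDirDeriv, LocConvex.dirDeriv, HasDirDerivAt] using this

end Smooth

/-! ### Calculus of smooth maps -/

section SmoothCalculus

variable {E : Type u} {F : Type v} {G : Type w}
  [AddCommGroup E] [Module ℝ E] [TopologicalSpace E]
  [IsTopologicalAddGroup E] [ContinuousSMul ℝ E] [LocallyConvexSpace ℝ E]
  [AddCommGroup F] [Module ℝ F] [TopologicalSpace F]
  [IsTopologicalAddGroup F] [ContinuousSMul ℝ F] [LocallyConvexSpace ℝ F] [T2Space F]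
  [AddCommGroup G] [Module ℝ G] [TopologicalSpace G]
  [IsTopologicalAddGroup G] [ContinuousSMul ℝ G] [LocallyConvexSpace ℝ G] [T2Space G]

theorem SmoothOn.congr {f g : E → F} {U : Set E} (hU : IsOpen U) (hf : SmoothOn f U)
    (h : ∀ x ∈ U, g x = f x) : SmoothOn g U :=
  smoothOn_of_ckOn hU fun n => (hf.ckOn hU n).congr hU h

theorem smoothOn_const (c : F) {U : Set E} (hU : IsOpen U) : SmoothOn (fun _ : E => c) U :=
  smoothOn_of_ckOn hU fun n => CkOn.const n c U

theorem smoothOn_id {U : Set F} (hU : IsOpen U) : SmoothOn (fun x : F => x) U :=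
  smoothOn_of_ckOn hU fun n => CkOn.clm n (ContinuousLinearMap.id ℝ F) U

theorem SmoothOn.add {f g : E → F} {U : Set E} (hU : IsOpen U) (hf : SmoothOn f U)
    (hg : SmoothOn g U) : SmoothOn (fun x => f x + g x) U :=
  smoothOn_of_ckOn hU fun n => (hf.ckOn hU n).add hU (hg.ckOn hU n)

theorem SmoothOn.sub {f g : E → F} {U : Set E} (hU : IsOpen U) (hf : SmoothOn f U)
    (hg : SmoothOn g U) : SmoothOn (fun x => f x - g x) U :=
  smoothOn_of_ckOn hU fun n => (hf.ckOn hU n).sub hU (hg.ckOn hU n)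

theorem SmoothOn.smul {c : E → ℝ} {f : E → F} {U : Set E} (hU : IsOpen U) (hc : SmoothOn c U)
    (hf : SmoothOn f U) : SmoothOn (fun x => c x • f x) U :=
  smoothOn_of_ckOn hU fun n => (hc.ckOn hU n).smul hU (hf.ckOn hU n)

theorem SmoothOn.prodMk {f : E → F} {g : E → G} {U : Set E} (hU : IsOpen U)
    (hf : SmoothOn f U) (hg : SmoothOn g U) : SmoothOn (fun x => (f x, g x)) U :=
  smoothOn_of_ckOn hU fun n => (hf.ckOn hU n).prodMk (hg.ckOn hU n)

theorem SmoothOn.comp {g : F → G} {f : E → F} {U : Set E} {V : Set F} (hU : IsOpen U)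
    (hV : IsOpen V) (hg : SmoothOn g V) (hf : SmoothOn f U) (h : MapsTo f U V) :
    SmoothOn (fun x => g (f x)) U :=
  smoothOn_of_ckOn hU fun n => (hg.ckOn hV n).comp hU hV (hf.ckOn hU n) h

theorem SmoothOn.hasDirDerivAt {f : E → F} {U : Set E} (hU : IsOpen U) (hf : SmoothOn f U)
    {x : E} (hx : x ∈ U) (h : E) : HasDirDerivAt f (dirDeriv f x h) x h :=
  (hf.ckOn hU 1).hasDirDerivAt hx h

theorem SmoothOn.dirDeriv {f : E → F} {U : Set E} (hU : IsOpen U) (hf : SmoothOn f U) :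
    SmoothOn (fun q : E × E => dirDeriv f q.1 q.2) (U ×ˢ univ) :=
  smoothOn_of_ckOn (hU.prod isOpen_univ) fun n => (hf.ckOn hU (n + 1)).dirDeriv hU

theorem SmoothOn.dirDeriv_add_smul {f : E → F} {U : Set E} (hU : IsOpen U) (hf : SmoothOn f U)
    {x : E} (hx : x ∈ U) (h k : E) (c : ℝ) : LocConvex.dirDeriv f x (h + c • k)
      = LocConvex.dirDeriv f x h + c • LocConvex.dirDeriv f x k :=
  (hf.ckOn hU 1).dirDeriv_add_smul hU hx h k c

theorem SmoothOn.dirDeriv_apply {X Y : E → E} {U : Set E} [T2Space E] (hU : IsOpen U)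
    (hX : SmoothOn X U) (hY : SmoothOn Y U) :
    SmoothOn (fun x => LocConvex.dirDeriv X x (Y x)) U :=
  SmoothOn.comp (g := fun q : E × E => LocConvex.dirDeriv X q.1 q.2) (f := fun x => (x, Y x)) hU
    (hU.prod isOpen_univ) (hX.dirDeriv hU)
    ((smoothOn_id hU).prodMk hU hY) fun _ hx => ⟨hx, mem_univ _⟩

theorem SmoothOn.hasDirDerivAt_comp {g : F → G} {V : Set F} (hV : IsOpen V) (hg : SmoothOn g V)
    {f : E → F} {x h : E} {l : F} (hx : f x ∈ V) (hf : HasDirDerivAt f l x h) :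
    HasDirDerivAt (fun y => g (f y)) (LocConvex.dirDeriv g (f x) l) x h :=
  (hg.ckOn hV 1).hasDirDerivAt_comp hV hx hf

theorem HasDirDerivAt.mul {f g : E → ℝ} {a b : ℝ} {x h : E} (hf : HasDirDerivAt f a x h)
    (hg : HasDirDerivAt g b x h) :
    HasDirDerivAt (fun y => f y * g y) (a * g x + f x * b) x h := by
  have := (ckOn_smul (F := ℝ) 1).hasDirDerivAt_comp isOpen_univ (mem_univ _) (hf.prodMk hg)
  rwa [(hasDirDerivAt_smul _ _).dirDeriv_eq] at this

/-- The second difference quotient of `f` converges to the second derivative, by two applications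
of the mean value theorem. -/
theorem tendsto_second_slope {f : E → ℝ} {A : E → ℝ} {U : Set E} (hU : IsOpen U) {u : E}
    (hf : ∀ y ∈ U, HasDirDerivAt f (A y) y u) (hA : CkOn 1 A U) {x : E} (hx : x ∈ U) (v : E) :
    Tendsto (fun t : ℝ => t⁻¹ • (t⁻¹ • (f (x + t • u + t • v) - f (x + t • u))
      - t⁻¹ • (f (x + t • v) - f x))) (𝓝[≠] 0) (𝓝 (dirDeriv A x v)) := by
  rw [tendsto_def]
  intro W hW
  obtain ⟨S, hS, hSc, hSW⟩ := (locallyConvexSpace_iff_exists_convex_subset ℝ ℝ).1 inferInstance _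
    W hW
  have hUo : IsOpen (U ×ˢ (univ : Set E)) := hU.prod isOpen_univ
  have hN : ∀ᶠ y in 𝓝 x, y ∈ U ∧ dirDeriv A y v ∈ interior S := by
    have h2 := ((hA.dirDeriv hU).continuousOn.continuousAt (x := (x, v))
      (hUo.mem_nhds ⟨hx, mem_univ v⟩)).tendsto.comp
      ((continuous_id.prodMk continuous_const).tendsto x : Tendsto (fun y => (y, v)) (𝓝 x) _)
    filter_upwards [hU.mem_nhds hx, h2.eventually
      (isOpen_interior.mem_nhds (mem_interior_iff_mem_nhds.2 hS))] with y h1 h2 using ⟨h1, h2⟩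
  have hT : ∀ᶠ t : ℝ in 𝓝 0, ∀ s ∈ Icc (0 : ℝ) 1 ×ˢ Icc (0 : ℝ) 1,
      x + (s.1 * t) • u + (s.2 * t) • v ∈ U ∧
        dirDeriv A (x + (s.1 * t) • u + (s.2 * t) • v) v ∈ interior S := by
    refine (isCompact_Icc.prod isCompact_Icc).eventually_forall_of_forall_eventually
      (P := fun (t : ℝ) (s : ℝ × ℝ) => x + (s.1 * t) • u + (s.2 * t) • v ∈ U ∧
        dirDeriv A (x + (s.1 * t) • u + (s.2 * t) • v) v ∈ interior S) fun s _ => ?_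
    have hcont : Tendsto (fun z : ℝ × ℝ × ℝ => x + (z.2.1 * z.1) • u + (z.2.2 * z.1) • v)
        (𝓝 (0, s)) (𝓝 (x + (s.1 * 0) • u + (s.2 * 0) • v)) :=
      Continuous.tendsto (by fun_prop) ((0 : ℝ), s)
    simp only [mul_zero, zero_smul, add_zero] at hcont
    exact hcont.eventually hN
  filter_upwards [nhdsWithin_le_nhds hT, self_mem_nhdsWithin] with t ht ht0
  refine hSW (interior_subset ?_)
  have h0 : (0 : ℝ) ∈ Icc (0 : ℝ) 1 := ⟨le_rfl, zero_le_one⟩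
  have h1 : (1 : ℝ) ∈ Icc (0 : ℝ) 1 := ⟨zero_le_one, le_rfl⟩
  -- The mean value theorem in the direction `u`, for the difference quotient in the direction `v`.
  refine slope_mem_of_hasDirDerivAt (f := fun y => t⁻¹ • (f (y + t • v) - f y)) (x := x) (h := u)
    ht0 hSc.interior isOpen_interior fun s hs => ⟨t⁻¹ • (A (x + (s * t) • u + t • v)
      - A (x + (s * t) • u)), ?_, ?_⟩
  · exact slope_mem_of_hasDirDerivAt ht0 hSc.interior isOpen_interior fun r hr =>
      ⟨_, (ht (s, r) ⟨hs, hr⟩).2, hA.hasDirDerivAt (ht (s, r) ⟨hs, hr⟩).1 v⟩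
  · have e1 : HasDirDerivAt (fun y => f (y + t • v)) (A (x + (s * t) • u + t • v))
        (x + (s * t) • u) u := by
      have := hf _ (ht (s, 1) ⟨hs, h1⟩).1
      simp only [one_mul] at this
      refine this.congr fun r => ?_
      rw [add_right_comm]
    have e2 : HasDirDerivAt f (A (x + (s * t) • u)) (x + (s * t) • u) u := by
      have := hf _ (ht (s, 0) ⟨hs, h0⟩).1
      simpa only [zero_mul, zero_smul, add_zero] using this
    simpa only [sub_eq_add_neg] using (e1.add e2.neg).const_smul t⁻¹

/-- Second derivatives of real functions are symmetric. -/
theorem dirDeriv_comm {f : E → ℝ} {A : E → E → ℝ} {U : Set E} (hU : IsOpen U)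
    (hf : ∀ y ∈ U, ∀ v, HasDirDerivAt f (A y v) y v) (hA : ∀ v, CkOn 1 (fun y => A y v) U)
    {x : E} (hx : x ∈ U) (u v : E) :
    LocConvex.dirDeriv (fun y => A y u) x v = LocConvex.dirDeriv (fun y => A y v) x u := by
  refine tendsto_nhds_unique (tendsto_second_slope hU (fun y hy => hf y hy u) (hA u) hx v)
    ((tendsto_second_slope hU (fun y hy => hf y hy v) (hA v) hx u).congr fun t => ?_)
  rw [add_right_comm x (t • v)]
  simp only [smul_eq_mul]
  ring

end SmoothCalculus

/-! ### Hamiltonian vector fields on an open subset of the model space -/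

section Local

variable {E : Type u} [AddCommGroup E] [Module ℝ E] [TopologicalSpace E]
  [IsTopologicalAddGroup E] [ContinuousSMul ℝ E] [LocallyConvexSpace ℝ E] [T2Space E]

/-- `Ω` is a smooth `2`-form on the subset `U` of the model space. It is a plain function of its
arguments, as the values at points outside of `U` do not matter. -/
structure LocalTwoForm (Ω : E → E → E → ℝ) (U : Set E) : Prop where
  isOpen : IsOpen U
  bilin : ∀ y ∈ U, ∃ B : E →ₗ[ℝ] E →ₗ[ℝ] ℝ, (∀ v, B v v = 0) ∧ ∀ v w, Ω y v w = B v w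
  smooth : SmoothOn (fun q : E × E × E => Ω q.1 q.2.1 q.2.2) (U ×ˢ univ)

namespace LocalTwoForm

variable {Ω : E → E → E → ℝ} {U : Set E} (hΩ : LocalTwoForm Ω U)
include hΩ

theorem swap {y : E} (hy : y ∈ U) (v w : E) : Ω y w v = -Ω y v w := by
  obtain ⟨B, hB, h⟩ := hΩ.bilin y hy
  have := hB (v + w)
  simp only [map_add, LinearMap.add_apply, hB] at this
  rw [h, h]
  linarith

theorem sub_left {y : E} (hy : y ∈ U) (a b w : E) : Ω y (a - b) w = Ω y a w - Ω y b w := by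
  obtain ⟨B, -, h⟩ := hΩ.bilin y hy
  simp [h]

theorem zero_left {y : E} (hy : y ∈ U) (w : E) : Ω y 0 w = 0 := by
  obtain ⟨B, -, h⟩ := hΩ.bilin y hy
  simp [h]

theorem smoothOn_apply {X Y : E → E} (hX : SmoothOn X U) (hY : SmoothOn Y U) :
    SmoothOn (fun y => Ω y (X y) (Y y)) U :=
  SmoothOn.comp hΩ.isOpen (hΩ.isOpen.prod isOpen_univ) hΩ.smooth
    ((smoothOn_id hΩ.isOpen).prodMk hΩ.isOpen (hX.prodMk hΩ.isOpen hY))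
    fun _ hx => ⟨hx, mem_univ _⟩

/-- The product rule for `Ω(X, Y)`: the derivative of `Ω` at the fixed vectors `X x` and `Y x`,
plus one term for each argument by bilinearity. -/
theorem hasDirDerivAt_apply {X Y : E → E} {x u X' Y' : E} (hx : x ∈ U)
    (hX : HasDirDerivAt X X' x u) (hY : HasDirDerivAt Y Y' x u) :
    HasDirDerivAt (fun y => Ω y (X y) (Y y))
      (dirDeriv (fun z => Ω z (X x) (Y x)) x u + Ω x X' (Y x) + Ω x (X x) Y') x u := by
  have hUo : IsOpen (U ×ˢ (univ : Set (E × E))) := hΩ.isOpen.prod isOpen_univ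
  have hid : HasDirDerivAt (fun y : E => y) u x u :=
    hasDirDerivAt_clm (ContinuousLinearMap.id ℝ E) x u
  have hm : (x, X x, Y x) ∈ U ×ˢ (univ : Set (E × E)) := ⟨hx, mem_univ _⟩
  have h1 := hΩ.smooth.hasDirDerivAt_comp hUo (f := fun y => (y, X y, Y y)) hm
    (hid.prodMk (hX.prodMk hY))
  convert h1 using 1
  have hdec : (u, X', Y') = (u, 0, 0) + (1 : ℝ) • ((0, X', 0) + (1 : ℝ) • ((0, 0, Y') : E × E × E))
      := by simp
  rw [hdec, hΩ.smooth.dirDeriv_add_smul hUo hm, hΩ.smooth.dirDeriv_add_smul hUo hm]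
  obtain ⟨B, -, hB⟩ := hΩ.bilin x hx
  have e1 : HasDirDerivAt (fun q : E × E × E => Ω q.1 q.2.1 q.2.2) (Ω x X' (Y x))
      (x, X x, Y x) (0, X', 0) := by
    refine tendsto_const_nhds.congr' ?_
    filter_upwards [self_mem_nhdsWithin] with t ht
    simp [hB, inv_mul_cancel_left₀ (show t ≠ 0 from ht)]
  have e2 : HasDirDerivAt (fun q : E × E × E => Ω q.1 q.2.1 q.2.2) (Ω x (X x) Y')
      (x, X x, Y x) (0, 0, Y') := by
    refine tendsto_const_nhds.congr' ?_
    filter_upwards [self_mem_nhdsWithin] with t ht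
    simp [hB, inv_mul_cancel_left₀ (show t ≠ 0 from ht)]
  rw [e1.dirDeriv_eq, e2.dirDeriv_eq]
  simp [dirDeriv, add_assoc]

/-- The derivative of `Ω` in the base point is alternating in the other two arguments. -/
theorem dirDeriv_swap {x : E} (hx : x ∈ U) (u v w : E) :
    dirDeriv (fun z => Ω z w v) x u = -dirDeriv (fun z => Ω z v w) x u := by
  have h := (hΩ.hasDirDerivAt_apply hx (hasDirDerivAt_const v x u)
    (hasDirDerivAt_const w x u)).neg
  rw [← (hΩ.hasDirDerivAt_apply hx (hasDirDerivAt_const v x u)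
    (hasDirDerivAt_const w x u)).dirDeriv_eq] at h
  rw [← h.dirDeriv_eq]
  refine dirDeriv_congr ?_ u
  filter_upwards [hΩ.isOpen.mem_nhds hx] with y hy using hΩ.swap hy v w

variable {f g : E → ℝ} {X Y Z : E → E}

/-- The symmetry of the second derivative of `f`, where `df = Ω(X, ·)`. -/
theorem hessian_symm (hX : SmoothOn X U)
    (hf : ∀ y ∈ U, ∀ v, HasDirDerivAt f (Ω y (X y) v) y v) {x : E} (hx : x ∈ U) (u v : E) :
    dirDeriv (fun z => Ω z (X x) v) x u + Ω x (dirDeriv X x u) v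
      = dirDeriv (fun z => Ω z (X x) u) x v + Ω x (dirDeriv X x v) u := by
  have hd : ∀ a b, dirDeriv (fun y => Ω y (X y) a) x b
      = dirDeriv (fun z => Ω z (X x) a) x b + Ω x (dirDeriv X x b) a := fun a b => by
    rw [(hΩ.hasDirDerivAt_apply hx (hX.hasDirDerivAt hΩ.isOpen hx b)
      (hasDirDerivAt_const a x b)).dirDeriv_eq, hΩ.swap hx 0 (X x), hΩ.zero_left hx]
    simp
  rw [← hd, ← hd]
  exact dirDeriv_comm hΩ.isOpen hf (fun a => (hΩ.smoothOn_apply hX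
    (smoothOn_const a hΩ.isOpen)).ckOn hΩ.isOpen 1) hx v u

/-- If `df = Ω(X, ·)` and `dg = Ω(Y, ·)` with `Ω` closed, then `Ω(X, Y)` has the Hamiltonian
vector field `dX(Y) - dY(X)`, a Lie bracket of `X` and `Y`. -/
theorem hasDirDerivAt_bracket (hX : SmoothOn X U) (hY : SmoothOn Y U)
    (hf : ∀ y ∈ U, ∀ v, HasDirDerivAt f (Ω y (X y) v) y v)
    (hg : ∀ y ∈ U, ∀ v, HasDirDerivAt g (Ω y (Y y) v) y v)
    (hcl : ∀ y ∈ U, ∀ u v w, dirDeriv (fun z => Ω z v w) y u - dirDeriv (fun z => Ω z u w) y v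
      + dirDeriv (fun z => Ω z u v) y w = 0) {x : E} (hx : x ∈ U) (v : E) :
    HasDirDerivAt (fun y => Ω y (X y) (Y y))
      (Ω x (dirDeriv X x (Y x) - dirDeriv Y x (X x)) v) x v := by
  convert hΩ.hasDirDerivAt_apply hx (hX.hasDirDerivAt hΩ.isOpen hx v)
    (hY.hasDirDerivAt hΩ.isOpen hx v) using 1
  have h1 := hΩ.hessian_symm hX hf hx (Y x) v
  have h2 := hΩ.hessian_symm hY hg hx (X x) v
  have h3 := hcl x hx v (X x) (Y x)
  have h4 := hΩ.swap hx (dirDeriv Y x v) (X x)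
  have h5 := hΩ.dirDeriv_swap hx (X x) v (Y x)
  have h6 := hΩ.dirDeriv_swap hx (Y x) v (X x)
  have h7 := hΩ.dirDeriv_swap hx v (X x) (Y x)
  rw [hΩ.sub_left hx]
  linarith

/-- The commutator identity `(dY(Z) - dZ(Y)) f = Z (Y f) - Y (Z f)`, where `df = Ω(X, ·)`. -/
theorem apply_bracket (hX : SmoothOn X U) (hY : SmoothOn Y U) (hZ : SmoothOn Z U)
    (hf : ∀ y ∈ U, ∀ v, HasDirDerivAt f (Ω y (X y) v) y v) {x : E} (hx : x ∈ U) :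
    Ω x (X x) (dirDeriv Y x (Z x) - dirDeriv Z x (Y x))
      = dirDeriv (fun y => Ω y (X y) (Y y)) x (Z x)
        - dirDeriv (fun y => Ω y (X y) (Z y)) x (Y x) := by
  have hd := fun u => hX.hasDirDerivAt hΩ.isOpen hx u
  rw [(hΩ.hasDirDerivAt_apply hx (hd _) (hY.hasDirDerivAt hΩ.isOpen hx _)).dirDeriv_eq,
    (hΩ.hasDirDerivAt_apply hx (hd _) (hZ.hasDirDerivAt hΩ.isOpen hx _)).dirDeriv_eq]
  have h1 := hΩ.hessian_symm hX hf hx (Z x) (Y x)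
  obtain ⟨B, -, hB⟩ := hΩ.bilin x hx
  simp only [hB, map_sub] at h1 ⊢
  linarith

end LocalTwoForm

end Local

/-! ### Tangent vectors and differentials in charts -/

section Charts

variable {E : Type u} [AddCommGroup E] [Module ℝ E] [TopologicalSpace E]
  [IsTopologicalAddGroup E] [ContinuousSMul ℝ E] [LocallyConvexSpace ℝ E] [T2Space E]
  {M : Type v} [TopologicalSpace M] [ChartedSpace E M]
  {e : OpenPartialHomeomorph M E} {p : M}

theorem hasDirDerivAt_ofCoord [SmoothManifold E M] (he : e ∈ atlas E M) (hp : p ∈ e.source)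
    (w : E) : HasDirDerivAt (fun y => chartAt E p (e.symm y)) (ofCoord e p w) (e p) w :=
  (SmoothManifold.smooth_transition e he _ (chart_mem_atlas E p)).hasDirDerivAt
    (e.isOpen_inter_preimage_symm (chartAt E p).open_source)
    ⟨e.map_source hp, by simp [e.left_inv hp]⟩ w

theorem hasDirDerivAt_toCoord [SmoothManifold E M] (he : e ∈ atlas E M) (hp : p ∈ e.source)
    (v : E) : HasDirDerivAt (fun y => e ((chartAt E p).symm y)) (toCoord e p v)
      (chartAt E p p) v :=
  (SmoothManifold.smooth_transition _ (chart_mem_atlas E p) e he).hasDirDerivAt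
    ((chartAt E p).isOpen_inter_preimage_symm e.open_source)
    ⟨mem_chart_target E p, by simpa using hp⟩ v

theorem toCoord_add_smul [SmoothManifold E M] (he : e ∈ atlas E M) (hp : p ∈ e.source)
    (v w : E) (c : ℝ) : toCoord e p (v + c • w) = toCoord e p v + c • toCoord e p w :=
  (SmoothManifold.smooth_transition _ (chart_mem_atlas E p) e he).dirDeriv_add_smul
    ((chartAt E p).isOpen_inter_preimage_symm e.open_source)
    ⟨mem_chart_target E p, by simpa using hp⟩ v w c

theorem ofCoord_add_smul [SmoothManifold E M] (he : e ∈ atlas E M) (hp : p ∈ e.source)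
    (v w : E) (c : ℝ) : ofCoord e p (v + c • w) = ofCoord e p v + c • ofCoord e p w :=
  (SmoothManifold.smooth_transition e he _ (chart_mem_atlas E p)).dirDeriv_add_smul
    (e.isOpen_inter_preimage_symm (chartAt E p).open_source)
    ⟨e.map_source hp, by simp [e.left_inv hp]⟩ v w c

theorem toCoord_zero (e : OpenPartialHomeomorph M E) (p : M) : toCoord e p (0 : E) = 0 :=
  (hasDirDerivAt_zero _ _).dirDeriv_eq

theorem toCoord_smul [SmoothManifold E M] (he : e ∈ atlas E M) (hp : p ∈ e.source)
    (v : E) (c : ℝ) : toCoord e p (c • v) = c • toCoord e p v := by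
  simpa [toCoord_zero] using toCoord_add_smul he hp 0 v c

theorem toCoord_ofCoord [SmoothManifold E M] (he : e ∈ atlas E M) (hp : p ∈ e.source) (w : E) :
    toCoord e p (ofCoord e p w) = w := by
  have h1 := (SmoothManifold.smooth_transition _ (chart_mem_atlas E p) e he).hasDirDerivAt_comp
    ((chartAt E p).isOpen_inter_preimage_symm e.open_source)
    (f := fun y => chartAt E p (e.symm y)) (x := e p) (by simp [e.left_inv hp, hp])
    (hasDirDerivAt_ofCoord he hp w)
  simp only [e.left_inv hp] at h1
  refine (h1.congr_of_eventuallyEq ?_).unique (hasDirDerivAt_clm (ContinuousLinearMap.id ℝ E) _ w)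
  filter_upwards [(e.isOpen_inter_preimage_symm (chartAt E p).open_source).mem_nhds
    (show e p ∈ _ from ⟨e.map_source hp, by simp [e.left_inv hp]⟩)] with y hy
  simp [(chartAt E p).left_inv hy.2, e.right_inv hy.1]

theorem ofCoord_toCoord [SmoothManifold E M] (he : e ∈ atlas E M) (hp : p ∈ e.source)
    (v : TSpace E p) : ofCoord e p (toCoord e p v) = v := by
  have h1 := (SmoothManifold.smooth_transition e he _ (chart_mem_atlas E p)).hasDirDerivAt_comp
    (e.isOpen_inter_preimage_symm (chartAt E p).open_source)
    (f := fun y => e ((chartAt E p).symm y)) (x := chartAt E p p)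
    (by simp [e.left_inv hp, e.map_source hp]) (hasDirDerivAt_toCoord he hp v)
  simp only [(chartAt E p).left_inv (mem_chart_source E p)] at h1
  refine (h1.congr_of_eventuallyEq ?_).unique (hasDirDerivAt_clm (ContinuousLinearMap.id ℝ E) _ v)
  filter_upwards [((chartAt E p).isOpen_inter_preimage_symm e.open_source).mem_nhds
    (show chartAt E p p ∈ _ from ⟨mem_chart_target E p, by simpa using hp⟩)] with y hy
  simp [e.left_inv hy.2, (chartAt E p).right_inv hy.1]

theorem SmoothFun.hasDirDerivAt_diff {H : M → ℝ} (hH : SmoothFun E H) (p : M) (v : TSpace E p) :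
    HasDirDerivAt (fun y => H ((chartAt E p).symm y)) (diff H p v) (chartAt E p p) v :=
  (hH _ (chart_mem_atlas E p)).hasDirDerivAt (chartAt E p).open_target (mem_chart_target E p) v

/-- The differential may be computed in any chart. -/
theorem SmoothFun.hasDirDerivAt_chart [SmoothManifold E M] {H : M → ℝ} (hH : SmoothFun E H)
    (he : e ∈ atlas E M) (hp : p ∈ e.source) (w : E) :
    HasDirDerivAt (fun y => H (e.symm y)) (diff H p (ofCoord e p w)) (e p) w := by
  have h1 := (hH _ (chart_mem_atlas E p)).hasDirDerivAt_comp (chartAt E p).open_target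
    (f := fun y => chartAt E p (e.symm y)) (x := e p) (by simp [e.left_inv hp])
    (hasDirDerivAt_ofCoord he hp w)
  simp only [e.left_inv hp] at h1
  refine h1.congr_of_eventuallyEq ?_
  filter_upwards [(e.isOpen_inter_preimage_symm (chartAt E p).open_source).mem_nhds
    (show e p ∈ _ from ⟨e.map_source hp, by simp [e.left_inv hp]⟩)] with y hy
  simp [(chartAt E p).left_inv hy.2]

/-! ### Smooth functions and vector fields -/

theorem smoothFun_const (c : ℝ) : SmoothFun E (fun _ : M => c) := fun e _ =>
  smoothOn_const c e.open_target

theorem SmoothFun.add {F G : M → ℝ} (hF : SmoothFun E F) (hG : SmoothFun E G) :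
    SmoothFun E (F + G) := fun e he => (hF e he).add e.open_target (hG e he)

theorem SmoothFun.mul {F G : M → ℝ} (hF : SmoothFun E F) (hG : SmoothFun E G) :
    SmoothFun E (F * G) := fun e he => (hF e he).smul e.open_target (hG e he)

theorem diff_const (c : ℝ) (p : M) (v : TSpace E p) : diff (fun _ => c) p v = 0 :=
  (hasDirDerivAt_const c _ _).dirDeriv_eq

theorem diff_add {F G : M → ℝ} (hF : SmoothFun E F) (hG : SmoothFun E G) (p : M)
    (v : TSpace E p) : diff (F + G) p v = diff F p v + diff G p v :=
  ((hF.hasDirDerivAt_diff p v).add (hG.hasDirDerivAt_diff p v)).dirDeriv_eq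

theorem diff_mul {F G : M → ℝ} (hF : SmoothFun E F) (hG : SmoothFun E G) (p : M)
    (v : TSpace E p) : diff (F * G) p v = diff F p v * G p + F p * diff G p v := by
  have h := ((hF.hasDirDerivAt_diff p v).mul (hG.hasDirDerivAt_diff p v)).dirDeriv_eq
  simp only [(chartAt E p).left_inv (mem_chart_source E p)] at h
  exact h

theorem diff_const_smul {F : M → ℝ} (hF : SmoothFun E F) (c : ℝ) (p : M)
    (v : TSpace E p) : diff (c • F) p v = c * diff F p v :=
  ((hF.hasDirDerivAt_diff p v).const_smul c).dirDeriv_eq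

theorem smoothVF_zero : SmoothVF (fun p : M => (0 : TSpace E p)) := fun e _ =>
  (smoothOn_const (0 : E) e.open_target).congr e.open_target fun _ _ => toCoord_zero e _

theorem SmoothVF.add [SmoothManifold E M] {X Y : (p : M) → TSpace E p} (hX : SmoothVF X)
    (hY : SmoothVF Y) : SmoothVF (fun p => X p + Y p) := fun e he =>
  ((hX e he).add e.open_target (hY e he)).congr e.open_target fun y hy => by
    simpa using toCoord_add_smul he (e.map_target hy) (X (e.symm y)) (Y (e.symm y)) 1

theorem SmoothVF.smul [SmoothManifold E M] {F : M → ℝ} {X : (p : M) → TSpace E p}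
    (hF : SmoothFun E F) (hX : SmoothVF X) : SmoothVF (fun p => F p • X p) := fun e he =>
  ((hF e he).smul e.open_target (hX e he)).congr e.open_target fun y hy =>
    toCoord_smul he (e.map_target hy) (X (e.symm y)) _

/-- The coordinate expression `E → E` of a vector field in a chart. -/
noncomputable def vfInChart (X : (p : M) → TSpace E p) (e : OpenPartialHomeomorph M E) (y : E) :
    E :=
  toCoord e (e.symm y) (X (e.symm y))

theorem SmoothVF.smoothOn_vfInChart {X : (p : M) → TSpace E p} (hX : SmoothVF X)
    (he : e ∈ atlas E M) : SmoothOn (vfInChart X e) e.target :=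
  hX e he

namespace TwoForm

variable (ω : TwoForm E M)

theorem form_swap (p : M) (v w : TSpace E p) : ω.form p w v = -ω.form p v w := by
  have := ω.alternating p (v + w)
  simp only [map_add, LinearMap.add_apply, ω.alternating] at this
  linarith

theorem localTwoForm_inChart [SmoothManifold E M] (he : e ∈ atlas E M) :
    LocalTwoForm (ω.inChart e) e.target where
  isOpen := e.open_target
  bilin y hy := by
    have hs := e.map_target hy
    have hz : ofCoord e (e.symm y) (0 : E) = 0 := (hasDirDerivAt_zero _ _).dirDeriv_eq
    let L : E →ₗ[ℝ] E :=
      { toFun := ofCoord e (e.symm y)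
        map_add' := fun v w => by simpa using ofCoord_add_smul he hs v w 1
        map_smul' := fun c v => by simpa [hz] using ofCoord_add_smul he hs 0 v c }
    exact ⟨(ω.form (e.symm y)).compl₁₂ L L, fun v => ω.alternating _ _, fun v w => rfl⟩
  smooth := ω.smooth e he

theorem inChart_vfInChart [SmoothManifold E M] (he : e ∈ atlas E M) {y : E} (hy : y ∈ e.target)
    (X : (p : M) → TSpace E p) (w : E) :
    ω.inChart e y (vfInChart X e y) w = ω.form (e.symm y) (X (e.symm y)) (ofCoord e _ w) := by
  rw [inChart, vfInChart, ofCoord_toCoord he (e.map_target hy)]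

theorem inChart_vfInChart_vfInChart [SmoothManifold E M] (he : e ∈ atlas E M) {y : E}
    (hy : y ∈ e.target) (X Y : (p : M) → TSpace E p) :
    ω.inChart e y (vfInChart X e y) (vfInChart Y e y)
      = ω.form (e.symm y) (X (e.symm y)) (Y (e.symm y)) := by
  rw [ω.inChart_vfInChart he hy, vfInChart, ofCoord_toCoord he (e.map_target hy)]

variable {ω}

theorem smoothFun_form [SmoothManifold E M] {X Y : (p : M) → TSpace E p} (hX : SmoothVF X)
    (hY : SmoothVF Y) : SmoothFun E (fun p => ω.form p (X p) (Y p)) := fun e he =>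
  ((ω.localTwoForm_inChart he).smoothOn_apply (hX.smoothOn_vfInChart he)
    (hY.smoothOn_vfInChart he)).congr e.open_target
    fun _ hy => (ω.inChart_vfInChart_vfInChart he hy X Y).symm

/-! ### Hamiltonian vector fields -/

theorem IsHamiltonianVF.hasDirDerivAt_chart [SmoothManifold E M] {H : M → ℝ}
    {X : (p : M) → TSpace E p} (hX : ω.IsHamiltonianVF H X) (hH : SmoothFun E H)
    (he : e ∈ atlas E M) {y : E} (hy : y ∈ e.target) (v : E) :
    HasDirDerivAt (fun z => H (e.symm z)) (ω.inChart e y (vfInChart X e y) v) y v := by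
  have := hH.hasDirDerivAt_chart he (e.map_target hy) v
  rwa [hX.2, ← ω.inChart_vfInChart he hy, e.right_inv hy] at this

theorem isHamiltonianVF_const (c : ℝ) :
    ω.IsHamiltonianVF (fun _ => c) (fun p => (0 : TSpace E p)) :=
  ⟨smoothVF_zero, fun p v => by simp [diff_const]⟩

theorem IsHamiltonianVF.add [SmoothManifold E M] {F G : M → ℝ} {X Y : (p : M) → TSpace E p}
    (hF : SmoothFun E F) (hG : SmoothFun E G) (hX : ω.IsHamiltonianVF F X)
    (hY : ω.IsHamiltonianVF G Y) : ω.IsHamiltonianVF (F + G) (fun p => X p + Y p) :=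
  ⟨hX.1.add hY.1, fun p v => by
    rw [diff_add hF hG, hX.2, hY.2, map_add, LinearMap.add_apply]⟩

theorem IsHamiltonianVF.mul [SmoothManifold E M] {F G : M → ℝ} {X Y : (p : M) → TSpace E p}
    (hF : SmoothFun E F) (hG : SmoothFun E G) (hX : ω.IsHamiltonianVF F X)
    (hY : ω.IsHamiltonianVF G Y) :
    ω.IsHamiltonianVF (F * G) (fun p => F p • Y p + G p • X p) :=
  ⟨(hY.1.smul hF).add (hX.1.smul hG), fun p v => by
    rw [diff_mul hF hG, hX.2, hY.2, map_add, map_smul, map_smul]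
    simp only [LinearMap.add_apply, LinearMap.smul_apply, smul_eq_mul]
    ring⟩

/-- The coordinate expression `dX(Y) - dY(X)` in a chart of the Lie bracket of `X` and `Y` (with
the sign for which it is the Hamiltonian vector field of `ω(X, Y)`). -/
noncomputable def bracketInChart (X Y : (p : M) → TSpace E p) (e : OpenPartialHomeomorph M E)
    (y : E) : E :=
  dirDeriv (vfInChart X e) y (vfInChart Y e y) - dirDeriv (vfInChart Y e) y (vfInChart X e y)

/-- The Lie bracket of vector fields, computed at each point `p` in the preferred chart at `p`. -/
noncomputable def bracketVF (X Y : (p : M) → TSpace E p) (p : M) : TSpace E p :=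
  ofCoord (chartAt E p) p (bracketInChart X Y (chartAt E p) (chartAt E p p))

section Bracket

variable [SmoothManifold E M] {F G H : M → ℝ} {X Y Z : (p : M) → TSpace E p}

theorem diff_form (hω : ω.Closed) (hF : SmoothFun E F) (hG : SmoothFun E G)
    (hX : ω.IsHamiltonianVF F X) (hY : ω.IsHamiltonianVF G Y) (he : e ∈ atlas E M)
    (hp : p ∈ e.source) (v : TSpace E p) :
    diff (fun p => ω.form p (X p) (Y p)) p v
      = ω.form p (ofCoord e p (bracketInChart X Y e (e p))) v := by
  have hy := e.map_source hp
  have h1 := (smoothFun_form (ω := ω) hX.1 hY.1).hasDirDerivAt_chart he hp (toCoord e p v)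
  have h2 := (ω.localTwoForm_inChart he).hasDirDerivAt_bracket
    (hX.1.smoothOn_vfInChart he) (hY.1.smoothOn_vfInChart he)
    (fun y hy v => hX.hasDirDerivAt_chart hF he hy v)
    (fun y hy v => hY.hasDirDerivAt_chart hG he hy v) (hω e he) hy (toCoord e p v)
  rw [ofCoord_toCoord he hp] at h1
  have h3 := h1.unique (h2.congr_of_eventuallyEq (by
    filter_upwards [e.open_target.mem_nhds hy] with y hy
      using ω.inChart_vfInChart_vfInChart he hy X Y))
  rw [h3, ← bracketInChart, inChart, e.left_inv hp, ofCoord_toCoord he hp]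

/-- The function `ω(X, Y)` has the Hamiltonian vector field `bracketVF X Y`. By non-degeneracy,
its differential determines the coordinate expressions of this vector field in all the charts,
hence `bracketVF` does not depend on the choice of charts. -/
theorem IsHamiltonianVF.bracketVF (hω : ω.Closed) (hnd : ω.Nondegenerate) (hF : SmoothFun E F)
    (hG : SmoothFun E G) (hX : ω.IsHamiltonianVF F X) (hY : ω.IsHamiltonianVF G Y) :
    ω.IsHamiltonianVF (fun p => ω.form p (X p) (Y p)) (bracketVF X Y) := by
  have hd : ∀ (p : M) (v : TSpace E p), diff (fun p => ω.form p (X p) (Y p)) p v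
      = ω.form p (TwoForm.bracketVF X Y p) v := fun p v =>
    diff_form hω hF hG hX hY (chart_mem_atlas E p) (mem_chart_source E p) v
  refine ⟨fun e he => ?_, hd⟩
  have hs : SmoothOn (bracketInChart X Y e) e.target :=
    ((hX.1.smoothOn_vfInChart he).dirDeriv_apply e.open_target
      (hY.1.smoothOn_vfInChart he)).sub e.open_target
      ((hY.1.smoothOn_vfInChart he).dirDeriv_apply e.open_target (hX.1.smoothOn_vfInChart he))
  refine hs.congr e.open_target fun y hy => ?_
  have hp := e.map_target hy
  have : TwoForm.bracketVF X Y (e.symm y)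
      = ofCoord e (e.symm y) (bracketInChart X Y e (e (e.symm y))) := by
    refine sub_eq_zero.1 (hnd (e.symm y) _ fun w => ?_)
    rw [map_sub, LinearMap.sub_apply, ← hd, diff_form hω hF hG hX hY he hp, sub_self]
  rw [this, toCoord_ofCoord he hp, e.right_inv hy]

/-- The Jacobi identity, in the form `[Y, Z] F = Z (Y F) - Y (Z F)`. -/
theorem form_bracketVF (hF : SmoothFun E F) (hX : ω.IsHamiltonianVF F X) (hY : SmoothVF Y)
    (hZ : SmoothVF Z) (p : M) :
    ω.form p (X p) (bracketVF Y Z p) = diff (fun p => ω.form p (X p) (Y p)) p (Z p)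
      - diff (fun p => ω.form p (X p) (Z p)) p (Y p) := by
  have he := chart_mem_atlas E p
  have hp := mem_chart_source E p
  set e := chartAt E p
  have hy := e.map_source hp
  have hd : ∀ Y Z : (p : M) → TSpace E p, SmoothVF Y →
      dirDeriv (fun y => ω.inChart e y (vfInChart X e y) (vfInChart Y e y)) (e p)
        (vfInChart Z e (e p)) = diff (fun p => ω.form p (X p) (Y p)) p (Z p) :=
      fun Y Z hY => by
    have h1 := (smoothFun_form (ω := ω) hX.1 hY).hasDirDerivAt_chart he hp (toCoord e p (Z p))
    rw [ofCoord_toCoord he hp] at h1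
    rw [vfInChart, e.left_inv hp, ← h1.dirDeriv_eq]
    refine dirDeriv_congr ?_ _
    filter_upwards [e.open_target.mem_nhds hy] with y hy
      using ω.inChart_vfInChart_vfInChart he hy X Y
  rw [← hd Y Z hY, ← hd Z Y hZ]
  refine Eq.trans ?_ ((ω.localTwoForm_inChart he).apply_bracket
    (hX.1.smoothOn_vfInChart he) (hY.smoothOn_vfInChart he) (hZ.smoothOn_vfInChart he)
    (fun y hy v => hX.hasDirDerivAt_chart hF he hy v) hy)
  have := ω.inChart_vfInChart he hy X (bracketInChart Y Z e (e p))
  rw [e.left_inv hp] at this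
  exact this.symm

end Bracket

/-! ### The Poisson algebra of admissible functions -/

/-- The admissible functions as a subalgebra. -/
def admissibleSubalgebra [SmoothManifold E M] (ω : TwoForm E M) : Subalgebra ℝ (M → ℝ) where
  carrier := ω.admissible
  mul_mem' := fun ⟨hF, _, hX⟩ ⟨hG, _, hY⟩ => ⟨hF.mul hG, _, hX.mul hF hG hY⟩
  add_mem' := fun ⟨hF, _, hX⟩ ⟨hG, _, hY⟩ => ⟨hF.add hG, _, hX.add hF hG hY⟩
  algebraMap_mem' c := ⟨smoothFun_const c, _, isHamiltonianVF_const c⟩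

section Poisson

variable [SmoothManifold E M]

theorem smoothFun_coe (F : ω.admissibleSubalgebra) : SmoothFun E (F : M → ℝ) := F.2.1

/-- A choice of a Hamiltonian vector field of an admissible function. -/
noncomputable def hamiltonianVF (F : ω.admissibleSubalgebra) : (p : M) → TSpace E p :=
  F.2.2.choose

theorem isHamiltonianVF_hamiltonianVF (F : ω.admissibleSubalgebra) :
    ω.IsHamiltonianVF F (hamiltonianVF F) :=
  F.2.2.choose_spec

/-- `ω(X_F, X_G)` does not depend on the choice of `X_F` and `X_G`: it is `dF(X_G)`, as well as
`-dG(X_F)`. -/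
theorem form_eq_form {F G : M → ℝ} {X X' Y Y' : (p : M) → TSpace E p}
    (hX : ω.IsHamiltonianVF F X) (hX' : ω.IsHamiltonianVF F X') (hY : ω.IsHamiltonianVF G Y)
    (hY' : ω.IsHamiltonianVF G Y') (p : M) :
    ω.form p (X p) (Y p) = ω.form p (X' p) (Y' p) := by
  rw [← hX.2, hX'.2, form_swap, ← hY.2, hY'.2, ← form_swap]

/-- The Poisson bracket `{F, G} = ω(X_F, X_G)`. -/
noncomputable def poissonBracket (hω : ω.Closed) (hnd : ω.Nondegenerate) :
    ω.admissibleSubalgebra →ₗ[ℝ] ω.admissibleSubalgebra →ₗ[ℝ] ω.admissibleSubalgebra :=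
  LinearMap.mk₂ ℝ
    (fun F G => ⟨fun p => ω.form p (hamiltonianVF F p) (hamiltonianVF G p),
      smoothFun_form (isHamiltonianVF_hamiltonianVF F).1 (isHamiltonianVF_hamiltonianVF G).1, _,
      (isHamiltonianVF_hamiltonianVF F).bracketVF hω hnd (smoothFun_coe F) (smoothFun_coe G)
        (isHamiltonianVF_hamiltonianVF G)⟩)
    (fun F F' G => Subtype.ext <| funext fun p => by
      change ω.form p _ _ = ω.form p _ _ + ω.form p _ _
      simp only [← (isHamiltonianVF_hamiltonianVF _).2]
      exact diff_add (smoothFun_coe F) (smoothFun_coe F') p _)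
    (fun c F G => Subtype.ext <| funext fun p => by
      change ω.form p _ _ = c * ω.form p _ _
      simp only [← (isHamiltonianVF_hamiltonianVF _).2]
      exact diff_const_smul (smoothFun_coe F) c p _)
    (fun F G G' => Subtype.ext <| funext fun p => by
      change ω.form p _ _ = ω.form p _ _ + ω.form p _ _
      simp only [ω.form_swap p _ (hamiltonianVF F p), ← (isHamiltonianVF_hamiltonianVF _).2]
      rw [← neg_add]
      exact congrArg _ (diff_add (smoothFun_coe G) (smoothFun_coe G') p _))
    (fun c F G => Subtype.ext <| funext fun p => by
      change ω.form p _ _ = c * ω.form p _ _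
      simp only [ω.form_swap p _ (hamiltonianVF F p), ← (isHamiltonianVF_hamiltonianVF _).2]
      rw [mul_neg]
      exact congrArg _ (diff_const_smul (smoothFun_coe G) c p _))

variable (hω : ω.Closed) (hnd : ω.Nondegenerate)

theorem poissonBracket_apply {F G : ω.admissibleSubalgebra} {X Y : (p : M) → TSpace E p}
    (hX : ω.IsHamiltonianVF F X) (hY : ω.IsHamiltonianVF G Y) (p : M) :
    (poissonBracket hω hnd F G : M → ℝ) p = ω.form p (X p) (Y p) :=
  form_eq_form (isHamiltonianVF_hamiltonianVF F) hX (isHamiltonianVF_hamiltonianVF G) hY p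

theorem poissonBracket_eq_diff (F G : ω.admissibleSubalgebra) (p : M) :
    (poissonBracket hω hnd F G : M → ℝ) p = diff (F : M → ℝ) p (hamiltonianVF G p) :=
  ((isHamiltonianVF_hamiltonianVF F).2 p _).symm

theorem poissonBracket_skew (F G : ω.admissibleSubalgebra) :
    poissonBracket hω hnd F G = -poissonBracket hω hnd G F :=
  Subtype.ext <| funext fun p => ω.form_swap p (hamiltonianVF G p) (hamiltonianVF F p)

theorem coe_poissonBracket (F G : ω.admissibleSubalgebra) :
    (poissonBracket hω hnd F G : M → ℝ)
      = fun p => ω.form p (hamiltonianVF F p) (hamiltonianVF G p) :=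
  rfl

theorem poissonBracket_jacobi (F G H : ω.admissibleSubalgebra) :
    poissonBracket hω hnd F (poissonBracket hω hnd G H)
      = poissonBracket hω hnd (poissonBracket hω hnd F G) H
        - poissonBracket hω hnd (poissonBracket hω hnd F H) G := by
  have hF := isHamiltonianVF_hamiltonianVF F
  have hG := isHamiltonianVF_hamiltonianVF G
  have hH := isHamiltonianVF_hamiltonianVF H
  have hGH : ω.IsHamiltonianVF (poissonBracket hω hnd G H : M → ℝ)
      (bracketVF (hamiltonianVF G) (hamiltonianVF H)) :=
    hG.bracketVF hω hnd (smoothFun_coe G) (smoothFun_coe H) hH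
  refine Subtype.ext <| funext fun p => ?_
  rw [AddSubgroupClass.coe_sub, Pi.sub_apply, poissonBracket_apply hω hnd hF hGH,
    poissonBracket_eq_diff, poissonBracket_eq_diff, coe_poissonBracket, coe_poissonBracket]
  exact form_bracketVF (smoothFun_coe F) hF hG.1 hH.1 p

theorem poissonBracket_mul_left (F G H : ω.admissibleSubalgebra) :
    poissonBracket hω hnd (G * H) F
      = poissonBracket hω hnd G F * H + G * poissonBracket hω hnd H F := by
  refine Subtype.ext <| funext fun p => ?_
  rw [poissonBracket_eq_diff, MulMemClass.coe_mul, diff_mul (smoothFun_coe G) (smoothFun_coe H),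
    ← poissonBracket_eq_diff hω hnd G, ← poissonBracket_eq_diff hω hnd H]
  rfl

theorem isPoissonBracket_poissonBracket : IsPoissonBracket (poissonBracket hω hnd) where
  skew := poissonBracket_skew hω hnd
  jacobi F G H := by
    rw [poissonBracket_skew hω hnd G (poissonBracket hω hnd F H), ← sub_eq_add_neg,
      poissonBracket_jacobi]
  leibniz F G H := by
    rw [poissonBracket_skew hω hnd F, poissonBracket_mul_left, poissonBracket_skew hω hnd F G,
      poissonBracket_skew hω hnd F H, neg_add]
    ring

end Poisson

end TwoForm

end Charts

end LocConvex

theorem proposition1p4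
    {E : Type*} [AddCommGroup E] [Module ℝ E] [TopologicalSpace E] [IsTopologicalAddGroup E]
    [ContinuousSMul ℝ E] [LocallyConvexSpace ℝ E] [T2Space E]
    {M : Type*} [TopologicalSpace M] [ChartedSpace E M] [LocConvex.SmoothManifold E M]
    (ω : LocConvex.TwoForm E M) (hclosed : ω.Closed) (hnondeg : ω.Nondegenerate) :
    ∃ A : Subalgebra ℝ (M → ℝ), (A : Set (M → ℝ)) = ω.admissible ∧
      ∃ br : A →ₗ[ℝ] A →ₗ[ℝ] A,
        (∀ (F G : A) (XF XG : (p : M) → LocConvex.TSpace E p),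
          ω.IsHamiltonianVF F XF → ω.IsHamiltonianVF G XG →
            ∀ p : M, (br F G : M → ℝ) p = ω.form p (XF p) (XG p) ∧
              ω.form p (XF p) (XG p) = LocConvex.diff (F : M → ℝ) p (XG p)) ∧
        LocConvex.IsPoissonBracket br ∧
        LocConvex.HasHamiltonianVF E A br ∧
        ((∀ (m : M) (v : LocConvex.TSpace E m),
            (∀ X ∈ ω.ham, ω.form m (X m) v = 0) → v = 0) →
          LocConvex.SeparatesTangent E A) := by
  refine ⟨ω.admissibleSubalgebra, rfl, LocConvex.TwoForm.poissonBracket hclosed hnondeg,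
    fun F G XF XG hF hG p =>
      ⟨LocConvex.TwoForm.poissonBracket_apply hclosed hnondeg hF hG p, (hF.2 p _).symm⟩,
    LocConvex.TwoForm.isPoissonBracket_poissonBracket hclosed hnondeg, fun H => ?_, ?_⟩
  · exact ⟨LocConvex.TwoForm.hamiltonianVF H,
      (LocConvex.TwoForm.isHamiltonianVF_hamiltonianVF H).1, fun F p =>
      (LocConvex.TwoForm.poissonBracket_eq_diff hclosed hnondeg F H p).symm⟩
  · intro hham m v hv
    refine hham m v fun X hX => ?_
    obtain ⟨H, hH, hHX⟩ := hX
    rw [← hHX.2]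
    exact hv H ⟨hH, X, hHX⟩
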